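/- **Setting.** Let $\mathfrak g$ be a complex finite-dimensional simple Lie algebra with Dynkin nodes $I$, Cartan matrix $(c_{ij})$ and minimal left symmetrizer $(d_i)$ (so $d_ic_{ij}=d_jc_{ji}$, and $d_i=1$ for short roots). Let $\mathcal M$ be the group of Laurent monomials in the variables $Y_{i,p}$, $(i,p)\in I\times\mathbb Z$. A monomial is $i$-dominant if no $Y_{i,p}$ has a negative exponent in it, and dominant if it is $i$-dominant for all $i$. Put $$A_{i,p}=Y_{i,p-d_i}Y_{i,p+d_i}\prod_{c_{ji}=-1}Y_{j,p}^{-1}\prod_{c_{ji}=-2}Y_{j,p-1}^{-1}Y_{j,p+1}^{-1}\prod_{c_{ji}=-3}Y_{j,p-2}^{-1}Y_{j,p}^{-1}Y_{j,p+2}^{-1},$$ and write $m'\le m$ if $m/m'$ is a monomial in the $A_{i,p}$. Let $C(z)$ be the matrix with diagonal entries $z^{d_i}+z^{-d_i}$ and off-diagonal entries $(z^{c_{ij}}-z^{-c_{ij}})/(z-z^{-1})$, let $c'_{ij}(u)$ be the coefficient of $z^u$ in the expansion at $z=0$ of $(C(z)^{-1})_{ij}$, and let $\gamma$ be the bilinear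 form on $\mathcal M$ with $\gamma(Y_{i,p},Y_{j,s})=\gamma_{ij}(p-s)$, $\gamma_{ij}(u)=c'_{ij}(u-d_i)-c'_{ij}(u+d_i)-c'_{ij}(-u-d_i)+c'_{ij}(-u+d_i)$. The quantum torus $\mathcal Y_t=\bigoplus_{m\in\mathcal M}\mathbb Z[t^{\pm1/2}]\,m$ has the product $m*m'=t^{\gamma(m,m')/2}mm'$. Let $K_{i,t}$ be its $\mathbb Z[t^{\pm1/2}]$-subalgebra generated by the $Y_{i,p}(1+A_{i,p+d_i}^{-1})$ and the $Y_{j,s}^{\pm1}$, $j\ne i$, and let $K_t=\bigcap_iK_{i,t}$. For $i$-dominant $m$ let $F_{i,t}(m)$ be the unique element of $K_{i,t}$ of the form $my$, with $y$ a polynomial over $\mathbb Z[t^{\pm1}]$ in the $A_{i,p}^{-1}$ with constant term $1$, in which $m$ is the only $i$-dominant monomial; $[F_{i,t}(m)]_{m'}$ denotes the coefficient of $m'$. **The elements $F_t(m)$ and $E_t(m)$.** For dominant $m$ put $F_t(m)=\sum_{m'\le m}s(m')\,m'$, where $s$ is given by the $t$-analog of the Frenkel–Mukhin algorithm: $s(m)=1$,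 $s_i(m)=0$ for all $i$, and, for $m'<m$, $$s_i(m')=\sum_{m'<u\le m,\ u\ i\text{-dominant}}\bigl(s(u)-s_i(u)\bigr)[F_{i,t}(u)]_{m'},$$ where $s(m')=0$ if $m'$ is dominant and otherwise $s(m')$ is the common value of the $s_i(m')$ over all $i$ for which $m'$ is not $i$-dominant. (By a theorem of Hernandez these values agree, and $F_t(m)$ is a finite sum; it is the unique element of $K_t$ of the form $m+\sum s(m')m'$, the sum over non-dominant $m'<m$, with $s(m')\in\mathbb Z[t^{\pm1}]$. The statement below is formulated so as not to depend on that theorem: $F_t(m)$ is regarded as a formal, possibly infinite, sum, with $s(m')=0$ where there is no common value, and $*$ is extended to formal sums bounded above.) For an ordered factorization $m=Y_{i_1,p_1}\cdots Y_{i_l,p_l}$ with $p_1\ge\dots\ge p_l$ put $$E_t(m)=t^{-\frac12\sum_{a<b}\gamma(Y_{i_a,p_a},Y_{i_b,p_b})}F_t(Y_{i_1,p_1})*\cdots*F_t(Y_{i_l,p_l}).$$ **Freezing.** Let $\tilde{\mathfrak g}$ be a second such Lie algebra, with nodes $\tilde I\supset I$ such that $\tilde c_{ij}=c_{ij}$ and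 $\tilde d_i=d_i$ for $i,j\in I$; its objects carry a tilde. Let $\mathrm{res}_I$ send $\tilde Y_{i,p}$ to $Y_{i,p}$ for $i\in I$ and to $1$ for $i\notin I$, extended to monomials and linearly to sums. Write $m'\le_Im$ if $m/m'$ is a monomial in the $\tilde A_{i,p}$ with $i\in I$. For an $m$-pointed sum $y=m+\sum_{m'<m}c_{m'}m'$ let $\mathfrak f(y)=\mathrm{res}_I\bigl(m+\sum_{m'<_Im}c_{m'}m'\bigr)$. **Proposition.** Let $m$ be a dominant monomial of $\tilde{\mathfrak g}$. 1. $\tilde F_t(m)$ is $m$-pointed and $\mathfrak f(\tilde F_t(m))=F_t(\mathrm{res}_I(m))$. 2. If $x\in\tilde K_t$ has the form $x=m+\sum s(m')m'$, the sum over non-dominant $m'<m$, with $s(m')\in\mathbb Z[t^{\pm1}]$, then $x=\tilde F_t(m)$, and $\mathfrak f(x)$ is the unique element of $K_t$ of the analogous form for $\mathrm{res}_I(m)$. 3. For every ordered factorization of $m$ as above, the element $\tilde E_t(m)$ formed with it is $m$-pointed, the subfamily of the factors $\tilde Y_{i_a,p_a}$ with $i_a\in I$ gives an ordered factorization of $\mathrm{res}_I(m)$,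 and $\mathfrak f(\tilde E_t(m))=E_t(\mathrm{res}_I(m))$, the right side formed with that factorization. -/

import Mathlib

namespace FreezingQT

/-! ### Cartan data, Laurent monomials, the Nakajima order -/

/-- The Cartan matrix `C` of a complex finite-dimensional simple Lie algebra, i.e. an indecomposable
Cartan matrix of finite type, with Dynkin nodes `I`, together with its minimal left symmetrizer `d`:
`d i * C i j = d j * C j i`, with `d i = 1` for the short roots. -/
structure CartanDatum (I : Type*) [Fintype I] where
  C : Matrix I I ℤ
  d : I → ℕ
  diag : ∀ i, C i i = 2
  offDiag : ∀ i j, i ≠ j → C i j ≤ 0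
  d_pos : ∀ i, 0 < d i
  symm : ∀ i j, (d i : ℤ) * C i j = (d j : ℤ) * C j i
  d_min : ∃ i, d i = 1
  posDef : ∀ x : I → ℝ, x ≠ 0 → 0 < ∑ i, ∑ j, (d i : ℝ) * (C i j : ℝ) * x i * x j
  connected : ∀ S : Set I, S.Nonempty → (∀ i ∈ S, ∀ j, C i j ≠ 0 → j ∈ S) → S = Set.univ

/-- Laurent monomials in the variables `Y_{i,p}`, `(i,p) ∈ I × ℤ`, written additively through their
exponents: the product of monomials is `+`, the monomial `1` is `0`. -/
abbrev Mon (I : Type*) := (I × ℤ) →₀ ℤ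

/-- Finitely supported families of multiplicities, i.e. exponents of the monomials in the `A_{i,p}`. -/
abbrev RootExp (I : Type*) := (I × ℤ) →₀ ℕ

/-- The coefficient ring `ℤ[t^{±1/2}]`; the generator `T 1` is `t^{1/2}`, so that `t^{k/2}` is
`LaurentPolynomial.T k`. -/
abbrev Coef := LaurentPolynomial ℤ

/-- Membership in the subring `ℤ[t^{±1}]` of `ℤ[t^{±1/2}]`: no odd powers of `t^{1/2}` occur. -/
def IsIntegralPow (a : Coef) : Prop := ∀ n : ℤ, a.coeff n ≠ 0 → Even n

/-- The variable `Y_{i,p}`. -/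
noncomputable def Y {I : Type*} (x : I × ℤ) : Mon I := Finsupp.single x 1

/-- `m` is `i`-dominant: no `Y_{i,p}` occurs in it with a negative exponent. -/
def IsDomAt {I : Type*} (i : I) (m : Mon I) : Prop := ∀ p : ℤ, 0 ≤ m (i, p)

/-- `m` is dominant. -/
def IsDom {I : Type*} (m : Mon I) : Prop := ∀ i, IsDomAt i m

section Datum

variable {I : Type*} [Fintype I] [DecidableEq I] (D : CartanDatum I)

/-- The monomial `A_{i,p}`: it is `Y_{i,p-d_i} Y_{i,p+d_i}` times, for every `j ≠ i`, the inverse of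
the product of the `Y_{j,p+e}` over `e = c-1, c-3, …, 1-c`, where `c = -c_{ji} ∈ {0, 1, 2, 3}`. -/
noncomputable def A (x : I × ℤ) : Mon I :=
  Y (x.1, x.2 - D.d x.1) + Y (x.1, x.2 + D.d x.1)
    - ∑ j ∈ Finset.univ.erase x.1, ∑ k ∈ Finset.range (D.C j x.1).natAbs,
        Y (j, x.2 + ((D.C j x.1).natAbs - 1 - 2 * (k : ℤ)))

/-- The monomial `∏ A_{i,p}^{v(i,p)}`. -/
noncomputable def Aprod (v : RootExp I) : Mon I := v.sum fun x n => n • A D x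

/-- The Nakajima order `m' ≤ m`: the quotient `m / m'` is a monomial in the `A_{i,p}`. -/
def NakLE (m' m : Mon I) : Prop := ∃ v : RootExp I, m' = m - Aprod D v

/-! ### The quantum torus -/

/-- The quantum integer `[c]_z = (z^c - z^{-c}) / (z - z^{-1})` in `ℤ((z))`. -/
noncomputable def qInt (c : ℤ) : LaurentSeries ℤ :=
  c.sign • ∑ k ∈ Finset.range c.natAbs, HahnSeries.single ((c.natAbs : ℤ) - 1 - 2 * (k : ℤ)) (1 : ℤ)

/-- The deformed Cartan matrix `C(z)`. -/
noncomputable def deformedC : Matrix I I (LaurentSeries ℤ) := fun i j =>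
  if i = j then HahnSeries.single (D.d i : ℤ) (1 : ℤ) + HahnSeries.single (-(D.d i : ℤ)) (1 : ℤ)
  else qInt (D.C i j)

/-- The coefficient `c'_{ij}(u)` of `z^u` in the `(i,j)` entry of `C(z)⁻¹`, expanded at `z = 0`.
(The determinant of `C(z)` has lowest term `z^{-∑ d_i}`, so it is invertible in `ℤ((z))`.) -/
noncomputable def cInv (i j : I) (u : ℤ) : ℤ := ((deformedC D)⁻¹ i j).coeff u

/-- `γ_{ij}(u)`. -/
noncomputable def gammaY (i j : I) (u : ℤ) : ℤ :=
  cInv D i j (u - D.d i) - cInv D i j (u + D.d i)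
    - cInv D i j (-u - D.d i) + cInv D i j (-u + D.d i)

/-- The bilinear form `γ` on monomials, with `γ(Y_{i,p}, Y_{j,s}) = γ_{ij}(p - s)`. -/
noncomputable def gamma (m m' : Mon I) : ℤ :=
  m.sum fun x a => m'.sum fun y b => a * b * gammaY D x.1 y.1 (x.2 - y.2)

theorem gamma_zero_left (m : Mon I) : gamma D 0 m = 0 := by simp [gamma]

theorem gamma_zero_right (m : Mon I) : gamma D m 0 = 0 := by simp [gamma]

theorem gamma_add_left (m n k : Mon I) : gamma D (m + n) k = gamma D m k + gamma D n k := by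
  classical
  unfold gamma
  rw [Finsupp.sum_add_index']
  · intro x; simp
  · intro x a b
    rw [← Finsupp.sum_add]
    refine Finsupp.sum_congr fun y _ => ?_
    ring

theorem gamma_add_right (m n k : Mon I) : gamma D m (n + k) = gamma D m n + gamma D m k := by
  classical
  unfold gamma
  rw [← Finsupp.sum_add]
  refine Finsupp.sum_congr fun x _ => ?_
  rw [Finsupp.sum_add_index']
  · intro y; simp
  · intro y a b
    ring

end Datum

/-- The quantum torus `𝒴_t`: finite sums `∑ c_m m` of monomials with coefficients in `ℤ[t^{±1/2}]`,
with the product determined by `m * m' = t^{γ(m,m')/2} m m'`. -/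
def QTorus {I : Type*} [Fintype I] [DecidableEq I] (_D : CartanDatum I) := Mon I →₀ Coef

namespace QTorus

variable {I : Type*} [Fintype I] [DecidableEq I] {D : CartanDatum I}

noncomputable instance : AddCommGroup (QTorus D) := inferInstanceAs (AddCommGroup (Mon I →₀ Coef))

noncomputable instance : Module Coef (QTorus D) := inferInstanceAs (Module Coef (Mon I →₀ Coef))

instance : FunLike (QTorus D) (Mon I) Coef := inferInstanceAs (FunLike (Mon I →₀ Coef) (Mon I) Coef)

variable (D) in
/-- The element `a m` of the quantum torus. -/
noncomputable def mono (m : Mon I) (a : Coef) : QTorus D := Finsupp.single m a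

variable (D) in
/-- The product of the quantum torus as a bilinear map. -/
noncomputable def mulMap : QTorus D →ₗ[Coef] QTorus D →ₗ[Coef] QTorus D :=
  Finsupp.lsum Coef fun m : Mon I => LinearMap.toSpanSingleton Coef _
    (Finsupp.lsum Coef fun n : Mon I => LinearMap.toSpanSingleton Coef (QTorus D)
      (mono D (m + n) (LaurentPolynomial.T (gamma D m n))))

noncomputable instance : Mul (QTorus D) := ⟨fun f g => mulMap D f g⟩

noncomputable instance : One (QTorus D) := ⟨mono D 0 1⟩

theorem mul_def (f g : QTorus D) : f * g = mulMap D f g := rfl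

theorem smul_mono (a b : Coef) (m : Mon I) : a • mono D m b = mono D m (a * b) :=
  Finsupp.smul_single' a m b

theorem mono_mul_mono (m n : Mon I) (a b : Coef) :
    mono D m a * mono D n b = mono D (m + n) (a * b * LaurentPolynomial.T (gamma D m n)) := by
  have h : mulMap D (mono D m a) (mono D n b)
      = (a • (b • mono D (m + n) (LaurentPolynomial.T (gamma D m n))) : QTorus D) := by
    have h1 : mulMap D (mono D m a) = a • mulMap D (mono D m 1) := by
      rw [← map_smul, smul_mono, mul_one]
    have h2 : mulMap D (mono D m 1) (mono D n b) = b • mulMap D (mono D m 1) (mono D n 1) := by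
      rw [← map_smul, smul_mono, mul_one]
    have h3 : mulMap D (mono D m 1) = Finsupp.lsum Coef fun n : Mon I =>
        LinearMap.toSpanSingleton Coef (QTorus D)
          (mono D (m + n) (LaurentPolynomial.T (gamma D m n))) :=
      (Finsupp.lsum_single Coef _ m 1).trans (one_smul Coef _)
    have h4 : mulMap D (mono D m 1) (mono D n 1)
        = mono D (m + n) (LaurentPolynomial.T (gamma D m n)) := by
      rw [h3]
      exact (Finsupp.lsum_single Coef _ n 1).trans
        (one_smul Coef _)
    rw [h1, LinearMap.smul_apply, h2, h4]
  rw [mul_def, h, smul_mono, smul_mono, mul_assoc]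

theorem induction_on {P : QTorus D → Prop} (f : QTorus D) (h0 : P 0)
    (hadd : ∀ f g, P f → P g → P (f + g)) (hm : ∀ m a, P (mono D m a)) : P f :=
  Finsupp.induction_linear (motive := P) f h0 hadd hm

noncomputable instance : Ring (QTorus D) :=
  { (inferInstance : AddCommGroup (QTorus D)) with
    mul := fun f g => f * g
    one := 1
    left_distrib := fun a b c => (mulMap D a).map_add b c
    right_distrib := fun a b c => by
      change mulMap D (a + b) c = mulMap D a c + mulMap D b c
      rw [map_add, LinearMap.add_apply]
    zero_mul := fun a => by
      change mulMap D 0 a = 0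
      rw [map_zero, LinearMap.zero_apply]
    mul_zero := fun a => (mulMap D a).map_zero
    mul_assoc := fun a b c => by
      change mulMap D (mulMap D a b) c = mulMap D a (mulMap D b c)
      induction a using induction_on with
      | h0 => simp
      | hadd f g hf hg => simp only [map_add, LinearMap.add_apply, hf, hg]
      | hm m x =>
        induction b using induction_on with
        | h0 => simp
        | hadd f g hf hg => simp only [map_add, LinearMap.add_apply, hf, hg]
        | hm n y =>
          induction c using induction_on with
          | h0 => simp
          | hadd f g hf hg => simp only [map_add, hf, hg]
          | hm k z =>
            simp only [← mul_def, mono_mul_mono]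
            rw [gamma_add_left, gamma_add_right, LaurentPolynomial.T_add, LaurentPolynomial.T_add,
              add_assoc]
            congr 1
            ring
    one_mul := fun a => by
      change mulMap D (mono D 0 1) a = a
      induction a using induction_on with
      | h0 => simp
      | hadd f g hf hg => rw [map_add, hf, hg]
      | hm m x => rw [← mul_def, mono_mul_mono, gamma_zero_left]; simp
    mul_one := fun a => by
      change mulMap D a (mono D 0 1) = a
      induction a using induction_on with
      | h0 => simp
      | hadd f g hf hg => rw [map_add, LinearMap.add_apply, hf, hg]
      | hm m x => rw [← mul_def, mono_mul_mono, gamma_zero_right]; simp }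

noncomputable instance : Algebra Coef (QTorus D) :=
  Algebra.ofModule
    (fun r x y => by
      change mulMap D (r • x) y = r • mulMap D x y
      rw [map_smul, LinearMap.smul_apply])
    (fun r x y => (mulMap D x).map_smul r y)

end QTorus

section Characters

variable {I : Type*} [Fintype I] [DecidableEq I] (D : CartanDatum I)

/-! ### The quantum Grothendieck ring -/

/-- `K_{i,t}`: the subalgebra of the quantum torus generated by the
`Y_{i,p} (1 + A_{i,p+d_i}⁻¹)` and the `Y_{j,s}^{±1}` with `j ≠ i`. -/
noncomputable def Ki (i : I) : Subalgebra Coef (QTorus D) :=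
  Algebra.adjoin Coef
    ({x | ∃ p : ℤ, x = QTorus.mono D (Y (i, p)) 1
        + QTorus.mono D (Y (i, p) - A D (i, p + D.d i)) 1} ∪
     {x | ∃ j : I, ∃ s : ℤ, j ≠ i ∧
        (x = QTorus.mono D (Y (j, s)) 1 ∨ x = QTorus.mono D (-Y (j, s)) 1)})

/-- The quantum Grothendieck ring `K_t = ⋂ K_{i,t}`. -/
noncomputable def Kt : Subalgebra Coef (QTorus D) := ⨅ i, Ki D i

/-- `x` is an element of `K_t` of the form `m + ∑ s(m') m'`, the sum over the non-dominant `m' < m`,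
with `s(m') ∈ ℤ[t^{±1}]`. -/
def IsFt (m : Mon I) (x : QTorus D) : Prop :=
  x ∈ Kt D ∧ x m = 1 ∧
    ∀ m', m' ≠ m → x m' ≠ 0 → NakLE D m' m ∧ ¬ IsDom m' ∧ IsIntegralPow (x m')

/-! ### The t-analog of the Frenkel–Mukhin algorithm -/

/-- `x` is an element `m + …` of `K_{i,t}` of the form `m y` with `y` a polynomial in the
`A_{i,p}⁻¹` over `ℤ[t^{±1}]`, such that `m` is the only `i`-dominant monomial occurring in it. -/
def IsFit (i : I) (m : Mon I) (x : QTorus D) : Prop :=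
  x ∈ Ki D i ∧ x m = 1 ∧
    ∀ m', x m' ≠ 0 →
      (∃ v : ℤ →₀ ℕ, m' = m - v.sum fun p n => n • A D (i, p)) ∧
      IsIntegralPow (x m') ∧ (IsDomAt i m' → m' = m)

open Classical in
/-- `F_{i,t}(m)` for an `i`-dominant monomial `m`: the (unique) element described by `IsFit`. -/
noncomputable def Fit (i : I) (m : Mon I) : QTorus D :=
  if h : ∃ x, IsFit D i m x then h.choose else 0

open Classical in
/-- The algorithm started at the monomial `m`. The monomials below `m` are the `m A^{-v}`, with
`v` running over finitely supported families of natural numbers; `(algo D m v).1` is `s(m A^{-v})`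
and `(algo D m v).2 i` is `s_i(m A^{-v})`.
* `s(m) = 1` and `s_i(m) = 0`;
* `s_i(m')` is the sum of `(s(u) - s_i(u)) [F_{i,t}(u)]_{m'}` over the `i`-dominant `u` with
  `m' < u ≤ m`;
* `s(m')` is the common value of the `s_i(m')` over all `i` such that `m'` is not `i`-dominant,
  and `0` if `m'` is dominant.

(That the relevant `s_i(m')` agree is a theorem; the value `0` is used where they would not.
If `m'` cannot be reached from `m`, all the sums for it vanish, so that it gets the coefficient `0`.) -/
noncomputable def algo (m : Mon I) (v : RootExp I) : Coef × (I → Coef) :=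
  if v = 0 then (1, 0)
  else
    let si : I → Coef := fun i => ∑ w ∈ (Finset.Iio v).attach,
      if IsDomAt i (m - Aprod D w.1) then
        ((algo m w.1).1 - (algo m w.1).2 i) * Fit D i (m - Aprod D w.1) (m - Aprod D v)
      else 0
    (if h : ∃ c : Coef, (∃ i, ¬ IsDomAt i (m - Aprod D v)) ∧
        ∀ i, ¬ IsDomAt i (m - Aprod D v) → si i = c then h.choose else 0, si)
termination_by v
decreasing_by
  all_goals exact Finset.mem_Iio.mp w.2

/-- Formal sums `∑ c_m m` of monomials with coefficients in `ℤ[t^{±1/2}]`, possibly infinite. The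
elements of the quantum torus are those with finite support. -/
abbrev FormalSum (I : Type*) := Mon I → Coef

open Classical in
/-- The element `F_t(m) = ∑ s(m') m'` produced by the algorithm, for a dominant monomial `m`. -/
noncomputable def Ft (m : Mon I) : FormalSum I := fun m' =>
  if h : ∃ v : RootExp I, m' = m - Aprod D v then (algo D m h.choose).1 else 0

/-! ### The standard basis -/

/-- The product `*` of formal sums: `m * m' = t^{γ(m,m')/2} m m'`. (For sums supported on monomials
below a given one, the sum for each coefficient is finite.) -/
noncomputable def fmul (f g : FormalSum I) : FormalSum I := fun n =>
  ∑ᶠ k : Mon I, LaurentPolynomial.T (gamma D k (n - k)) * f k * g (n - k)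

/-- The monomial `1` as a formal sum. -/
noncomputable def fone (I : Type*) : FormalSum I := ⇑(Finsupp.single (0 : Mon I) (1 : Coef))

/-- `L` is a factorization `m = Y_{i₁,p₁} ⋯ Y_{i_l,p_l}` with `p₁ ≥ p₂ ≥ ⋯ ≥ p_l`. -/
def IsOrderedFactorization (L : List (I × ℤ)) (m : Mon I) : Prop :=
  (L.map Y).sum = m ∧ L.Pairwise fun x y => y.2 ≤ x.2

/-- `∑_{a < b} γ(Y_{i_a,p_a}, Y_{i_b,p_b})`. -/
noncomputable def gammaList : List (I × ℤ) → ℤ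
  | [] => 0
  | x :: L => (L.map fun y => gamma D (Y x) (Y y)).sum + gammaList L

/-- The standard basis element `E_t(m)`, in terms of an ordered factorization `L` of `m`:
`t^{-½ ∑_{a<b} γ(Y_{i_a,p_a}, Y_{i_b,p_b})} F_t(Y_{i₁,p₁}) * ⋯ * F_t(Y_{i_l,p_l})`. -/
noncomputable def Et (L : List (I × ℤ)) : FormalSum I :=
  (LaurentPolynomial.T (-gammaList D L) : Coef) •
    (L.map fun x => Ft D (Y x)).foldr (fmul D) (fone I)

/-- `y` is `m`-pointed: it has the form `m + ∑ c_{m'} m'`, the sum over the `m' < m`. -/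
def IsPointed (m : Mon I) (y : FormalSum I) : Prop :=
  y m = 1 ∧ ∀ m', y m' ≠ 0 → NakLE D m' m

end Characters

/-! ### The freezing operator -/

section Freezing

variable {I J : Type*} [Fintype I] [DecidableEq I] [Fintype J] [DecidableEq J]

/-- The inclusion `ι` of Dynkin nodes is compatible with the Cartan matrices and symmetrizers. -/
def IsInclusion (D : CartanDatum I) (D' : CartanDatum J) (ι : I ↪ J) : Prop :=
  (∀ i j, D'.C (ι i) (ι j) = D.C i j) ∧ ∀ i, D'.d (ι i) = D.d i

/-- `res_I` on monomials: `Y_{i,p} ↦ Y_{i,p}` for `i ∈ I`, and `Y_{j,p} ↦ 1` for `j ∉ I`. -/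
noncomputable def res (ι : I ↪ J) (m : Mon J) : Mon I :=
  m.comapDomain (Prod.map ι id) ((ι.injective.prodMap Function.injective_id).injOn)

/-- `res_I` on factorizations: omit the factors `Y_{j,p}` with `j ∉ I`. -/
noncomputable def resList (ι : I ↪ J) (L : List (J × ℤ)) : List (I × ℤ) :=
  L.filterMap fun x => (Function.partialInv ι x.1).map fun i => (i, x.2)

/-- The order `m' ≤_I m`: the quotient `m / m'` is a monomial in the `A_{i,p}` with `i ∈ I`. -/
def NakLEOn (D' : CartanDatum J) (ι : I ↪ J) (m' m : Mon J) : Prop :=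
  ∃ v : RootExp I, m' = m - v.sum fun x n => n • A D' (ι x.1, x.2)

/-- Freezing of an `m`-pointed formal sum `y`: discard the terms `c_{m'} m'` with `m' ≰_I m`, then
apply `res_I` linearly. -/
noncomputable def freezeAt (D' : CartanDatum J) (ι : I ↪ J) (m : Mon J) (y : FormalSum J) :
    FormalSum I := fun n => ∑ᶠ m' ∈ {m' : Mon J | NakLEOn D' ι m' m ∧ res ι m' = n}, y m'

open Classical in
/-- The freezing operator on pointed formal sums (and `0` on the others). -/
noncomputable def freeze (D' : CartanDatum J) (ι : I ↪ J) (y : FormalSum J) : FormalSum I :=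
  if h : ∃ m, IsPointed D' m y then freezeAt D' ι h.choose y else 0

end Freezing

end FreezingQT

/-!
Freezing commutes with the algorithm because everything the algorithm sees is local in the Dynkin
nodes.

* *The form `γ` on the `A_{i,p}`.* The matrix `(z^{d_i} - z^{-d_i}) C_{ij}(z)` is symmetric. This
  holds since the symmetrizer of a finite type Cartan matrix takes at most two values, in the
  ratio `1`, `2` or `3` (`CartanDatum.d_le_three`), which is extracted from positive definiteness
  by a test vector. Together with the invertibility of `C(z)` over `ℤ((z))` it gives
  `γ(m, A_{i,p}) = 2 (m_{i,p+d_i} - m_{i,p-d_i}) = -γ(A_{i,p}, m)` (`gamma_A_right`,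
  `gamma_A_left`). So the values of `γ` on the `A_{i,p}` do not depend on the ambient Lie algebra,
  although `γ` itself does, and the `A_{i,p}` are multiplicatively independent
  (`Aprod_injective`).
* *The subalgebras `K_{i,t}`.* Two generators `Y_{i,p}(1 + A_{i,p+d_i}⁻¹)` commute up to a power of
  `t` and a multiple of a monomial in the other variables (`Xgen_swap`), so `K_{i,t}` is spanned by
  ordered words. A word has leading term an `i`-dominant monomial, and its other coefficients depend
  only on `d_i` and on its letters (`word_eq_realize`). Hence a nonzero element of `K_{i,t}` contains
  an `i`-dominant monomial (`eq_zero_of_no_isDomAt`), the `F_{i,t}(m)` exist and are unique, their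
  coefficients depend only on `d_i` and the `Y_{i,p}` in `m` (`Fit_eq_realize`), and every
  `x ∈ K_{i,t}` is the sum of the `x_u F_{i,t}(u)` over the `i`-dominant `u` (`eq_sum_Fit`).
* *Freezing.* The monomials `m' ≤_I m` stay dominant outside of `I`, so at them the algorithm for the
  large Lie algebra only uses the nodes in `I`, and it runs as the one for the small Lie algebra
  started at `res_I(m)` (`algo_incl`). An element of `K_t` whose only dominant monomial is `m` is
  computed by the algorithm, by its expansions in the `F_{i,t}(u)` (`algo_fst_eq_of_isFt`), and
  freezing such an element keeps from each of these expansions the terms with `u ≤_I m`, which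
  restrict to elements of `K_{i,t}` (`exists_mem_Ki_eq_freezeAt`). Finally the normalized product of
  pointed sums involves `γ` only through the `A_{i,p}` (`fmul_apply`), so freezing is multiplicative
  on the factors of `E_t(m)`, and those factors with node outside of `I` freeze to `1`.
-/

namespace FreezingQT

/-! ### Cartan matrices of finite type -/

namespace CartanDatum

/-- The indicator vector of a set of nodes. -/
def ind {I : Type*} [DecidableEq I] (T : Finset I) : I → ℝ := fun i => if i ∈ T then 1 else 0

theorem ind_insert {I : Type*} [DecidableEq I] {T : Finset I} {k : I} (hk : k ∉ T) :
    ind (insert k T) = ind T + Pi.single k 1 := by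
  funext j
  by_cases hj : j = k
  · subst hj; simp [ind, hk]
  · simp [ind, hj]

variable {I : Type*} [Fintype I] (D : CartanDatum I)

/-- The symmetric quadratic form `∑ d_i c_{ij} x_i x_j` of the Cartan matrix. -/
def form (x : I → ℝ) : ℝ := ∑ i, ∑ j, (D.d i : ℝ) * (D.C i j : ℝ) * x i * x j

/-- The linear form `∑_j d_k c_{kj} x_j`, half of the `k`-th partial derivative of `form`. -/
def formAt (k : I) (x : I → ℝ) : ℝ := ∑ j, (D.d k : ℝ) * (D.C k j : ℝ) * x j

theorem symm_real (i j : I) : (D.d i : ℝ) * (D.C i j : ℝ) = (D.d j : ℝ) * (D.C j i : ℝ) := by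
  exact_mod_cast D.symm i j

theorem one_le_d_real (i : I) : (1 : ℝ) ≤ (D.d i : ℝ) := by exact_mod_cast D.d_pos i

theorem form_zero : D.form 0 = 0 := by simp [form]

theorem form_pos {x : I → ℝ} (hx : x ≠ 0) : 0 < D.form x := D.posDef x hx

theorem formAt_add (k : I) (x y : I → ℝ) : D.formAt k (x + y) = D.formAt k x + D.formAt k y := by
  simp [formAt, mul_add, Finset.sum_add_distrib]

theorem C_eq_zero_comm {i j : I} (h : D.C i j = 0) : D.C j i = 0 := by
  have := D.symm i j
  rw [h, mul_zero] at this
  have hd := D.d_pos j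
  rcases mul_eq_zero.mp this.symm with h | h
  · omega
  · exact h

variable [DecidableEq I]

theorem formAt_single (k j : I) (t : ℝ) :
    D.formAt k (Pi.single j t) = (D.d k : ℝ) * (D.C k j : ℝ) * t := by
  simp [formAt, Pi.single_apply]

theorem form_add_single (x : I → ℝ) (k : I) (t : ℝ) :
    D.form (x + Pi.single k t) = D.form x + 2 * t * D.formAt k x + 2 * (D.d k : ℝ) * t ^ 2 := by
  have h1 : ∀ i j, (D.d i : ℝ) * (D.C i j : ℝ) * (x + Pi.single k t : I → ℝ) i * (x + Pi.single k t : I → ℝ) j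
      = (D.d i : ℝ) * (D.C i j : ℝ) * x i * x j
        + (if i = k then t * ((D.d k : ℝ) * (D.C k j : ℝ) * x j) else 0)
        + (if j = k then t * ((D.d k : ℝ) * (D.C k i : ℝ) * x i) else 0)
        + (if i = k then if j = k then 2 * (D.d k : ℝ) * t ^ 2 else 0 else 0) := by
    intro i j
    have := D.symm_real i j
    by_cases hi : i = k <;> by_cases hj : j = k
    · subst hi; subst hj
      simp [D.diag]; ring
    · subst hi
      simp [hj]; ring
    · subst hj
      simp only [Pi.add_apply, Pi.single_apply, hi, ↓reduceIte, this]; ring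
    · simp [hi, hj]
  unfold form
  simp only [h1, Finset.sum_add_distrib]
  have h2 : ∑ i, ∑ j, (if i = k then t * ((D.d k : ℝ) * (D.C k j : ℝ) * x j) else 0)
      = t * D.formAt k x := by
    rw [Finset.sum_comm]
    simp [formAt, Finset.mul_sum]
  have h3 : ∑ i, ∑ j, (if j = k then t * ((D.d k : ℝ) * (D.C k i : ℝ) * x i) else 0)
      = t * D.formAt k x := by
    simp [formAt, Finset.mul_sum]
  have h4 : ∑ i, ∑ j, (if i = k then if j = k then 2 * (D.d k : ℝ) * t ^ 2 else 0 else 0)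
      = 2 * (D.d k : ℝ) * t ^ 2 := by
    rw [Finset.sum_comm]
    simp
  rw [h2, h3, h4]
  ring

theorem C_mul_C_lt_four {i j : I} (hij : i ≠ j) : D.C i j * D.C j i < 4 := by
  have hs := D.symm_real i j
  have hi := D.one_le_d_real i
  have hj := D.one_le_d_real j
  -- the minimum of the form on the line through `e_i` and `e_j` is a multiple of `4 - c_ij c_ji`
  have hpos : 0 < D.form (Pi.single i (-((D.d i : ℝ) * (D.C i j : ℝ))) + Pi.single j (2 * (D.d i : ℝ))) := by
    apply D.form_pos
    intro h
    have := congrFun h j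
    simp only [Pi.add_apply, Pi.single_eq_of_ne hij.symm, Pi.single_eq_same, Pi.zero_apply] at this
    linarith
  have h0 : D.form (Pi.single i (-((D.d i : ℝ) * (D.C i j : ℝ))))
      = 2 * (D.d i : ℝ) * (-((D.d i : ℝ) * (D.C i j : ℝ))) ^ 2 := by
    have := D.form_add_single 0 i (-((D.d i : ℝ) * (D.C i j : ℝ)))
    rw [zero_add, D.form_zero] at this
    rw [this]
    simp [formAt]
  rw [form_add_single, formAt_single, h0, ← hs] at hpos
  have h1 : 0 < 2 * (D.d i : ℝ) * (D.d i : ℝ) * (D.d j : ℝ) * (4 - (D.C i j : ℝ) * (D.C j i : ℝ)) := by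
    have e : ((D.d i : ℝ) * (D.C i j : ℝ)) ^ 2
        = (D.d i : ℝ) * (D.d j : ℝ) * ((D.C i j : ℝ) * (D.C j i : ℝ)) := by
      rw [pow_two]; nth_rewrite 2 [hs]; ring
    nlinarith [e]
  have h2 : 0 < 4 - (D.C i j : ℝ) * (D.C j i : ℝ) := by
    by_contra hneg
    push Not at hneg
    have : 0 ≤ 2 * (D.d i : ℝ) * (D.d i : ℝ) * (D.d j : ℝ) := by positivity
    nlinarith [mul_nonneg this (neg_nonneg.mpr hneg)]
  have h3 : (D.C i j : ℝ) * (D.C j i : ℝ) < 4 := by linarith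
  exact_mod_cast h3

/-- One of the two entries of the Cartan matrix for an edge of the Dynkin diagram is `-1`. -/
theorem edge_cases {i j : I} (hij : i ≠ j) (h : D.C i j ≠ 0) :
    (D.C i j = -1 ∧ D.C j i < 0 ∧ (D.d i : ℤ) = D.d j * -D.C j i ∧ -3 ≤ D.C j i) ∨
    (D.C j i = -1 ∧ D.C i j < 0 ∧ (D.d j : ℤ) = D.d i * -D.C i j ∧ -3 ≤ D.C i j) := by
  have h1 : D.C i j ≤ -1 := by have := D.offDiag i j hij; omega
  have h2 : D.C j i ≤ -1 := by
    have := D.offDiag j i hij.symm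
    have h' : D.C j i ≠ 0 := fun h0 => h (D.C_eq_zero_comm h0)
    omega
  have h3 := D.C_mul_C_lt_four hij
  have hs := D.symm i j
  by_cases hc : D.C i j = -1
  · left
    rw [hc] at hs h3
    exact ⟨hc, by omega, by linarith, by linarith⟩
  · right
    have hc' : D.C j i = -1 := by
      by_contra hne
      have h4 : D.C i j ≤ -2 := by omega
      have h5 : D.C j i ≤ -2 := by omega
      nlinarith
    rw [hc'] at hs h3
    exact ⟨hc', by omega, by linarith, by linarith⟩

theorem two_mul_d_le {i j : I} (hij : i ≠ j) (h : D.C i j ≠ 0) (hd : D.d i ≠ D.d j) :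
    2 * D.d i ≤ D.d j ∨ 2 * D.d j ≤ D.d i := by
  rcases D.edge_cases hij h with ⟨-, hc, e, -⟩ | ⟨-, hc, e, -⟩
  · right
    have : -D.C j i ≠ 1 := by
      intro h1; rw [h1, mul_one] at e; exact hd (by exact_mod_cast e)
    have h2 : 2 ≤ -D.C j i := by omega
    have : (2 * D.d j : ℤ) ≤ D.d i := by rw [e]; nlinarith [D.d_pos j]
    exact_mod_cast this
  · left
    have : -D.C i j ≠ 1 := by
      intro h1; rw [h1, mul_one] at e; exact hd (by exact_mod_cast e.symm)
    have h2 : 2 ≤ -D.C i j := by omega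
    have : (2 * D.d i : ℤ) ≤ D.d j := by rw [e]; nlinarith [D.d_pos i]
    exact_mod_cast this

theorem d_le_three_mul {i j : I} (hij : i ≠ j) (h : D.C i j ≠ 0) : D.d i ≤ 3 * D.d j := by
  have hi := D.d_pos i
  have hj := D.d_pos j
  rcases D.edge_cases hij h with ⟨-, hc, e, h3⟩ | ⟨-, hc, e, -⟩
  · have : (D.d i : ℤ) ≤ 3 * D.d j := by rw [e]; nlinarith
    exact_mod_cast this
  · have : (D.d i : ℤ) ≤ 3 * D.d j := by rw [e]; nlinarith
    exact_mod_cast this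

theorem formAt_ind_le {T : Finset I} {k t : I} (hk : k ∉ T) (ht : t ∈ T) :
    D.formAt k (ind T) ≤ (D.d k : ℝ) * (D.C k t : ℝ) := by
  have h0 : ∀ j, (D.d k : ℝ) * (D.C k j : ℝ) * ind T j ≤ 0 := by
    intro j
    unfold ind
    split_ifs with hj
    · have : D.C k j ≤ 0 := D.offDiag k j (by rintro rfl; exact hk hj)
      have h' : (D.C k j : ℝ) ≤ 0 := by exact_mod_cast this
      nlinarith [D.one_le_d_real k]
    · simp
  unfold formAt
  rw [← Finset.add_sum_erase _ _ (Finset.mem_univ t)]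
  have h1 := Finset.sum_nonpos (s := Finset.univ.erase t) fun j _ => h0 j
  have h2 : ind T t = 1 := if_pos ht
  rw [h2, mul_one]
  linarith

/-- Every node lies in a set of nodes of equal `d` that supports a vector on which the form is as
small as on a single node, and that has no further neighbours with the same `d`. -/
theorem exists_level_set (i : I) : ∃ T : Finset I, i ∈ T ∧ (∀ t ∈ T, D.d t = D.d i) ∧
    D.form (ind T) ≤ 2 * (D.d i : ℝ) ∧
    ∀ k ∉ T, D.d k = D.d i → ∀ t ∈ T, D.C k t = 0 := by
  classical
  let S : Finset (Finset I) := Finset.univ.filter fun T => i ∈ T ∧ (∀ t ∈ T, D.d t = D.d i) ∧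
    D.form (ind T) ≤ 2 * (D.d i : ℝ)
  have hS : S.Nonempty := by
    refine ⟨{i}, ?_⟩
    have h := D.form_add_single 0 i 1
    have e : (0 : I → ℝ) + Pi.single i 1 = ind {i} := by
      funext j; by_cases hj : j = i <;> simp [ind, hj]
    rw [e, D.form_zero] at h
    simp only [S, Finset.mem_filter, Finset.mem_univ, true_and, Finset.mem_singleton, forall_eq]
    rw [h]
    simp [formAt]
  obtain ⟨T, hT, hmax⟩ := S.exists_max_image Finset.card hS
  simp only [S, Finset.mem_filter, Finset.mem_univ, true_and] at hT
  obtain ⟨hi, hd, hq⟩ := hT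
  refine ⟨T, hi, hd, hq, fun k hk hkd t ht => ?_⟩
  by_contra hne
  have hkt : k ≠ t := by rintro rfl; exact hk ht
  have h1 := D.formAt_ind_le hk ht
  have h2 : (D.C k t : ℝ) ≤ -1 := by
    have := D.offDiag k t hkt
    have : D.C k t ≤ -1 := by omega
    exact_mod_cast this
  have hmem : insert k T ∈ S := by
    simp only [S, Finset.mem_filter, Finset.mem_univ, true_and]
    refine ⟨Finset.mem_insert_of_mem hi, ?_, ?_⟩
    · intro s hs
      rcases Finset.mem_insert.mp hs with rfl | hs
      · exact hkd
      · exact hd s hs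
    · rw [ind_insert hk, form_add_single]
      nlinarith [D.one_le_d_real k]
  have := hmax _ hmem
  rw [Finset.card_insert_of_notMem hk] at this
  omega

/-- Attaching to a set with common value `e` of `d` a neighbour with another value of `d` lowers
the minimum of the form by at least `e`. -/
theorem exists_drop {T : Finset I} {k t : I} (hk : k ∉ T) (ht : t ∈ T) (h : D.C k t ≠ 0)
    (hd : D.d k ≠ D.d t) : ∃ s : ℝ, 0 ≤ s ∧
      2 * s * D.formAt k (ind T) + 2 * (D.d k : ℝ) * s ^ 2 ≤ -(D.d t : ℝ) := by
  have hkt : k ≠ t := by rintro rfl; exact hk ht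
  have h1 := D.formAt_ind_le hk ht
  have hC : D.C k t ≤ -1 := by
    have := D.offDiag k t hkt
    omega
  have hC' : D.C t k ≤ -1 := by
    have := D.offDiag t k hkt.symm
    have h' : D.C t k ≠ 0 := fun h0 => h (D.C_eq_zero_comm h0)
    omega
  have h2 : (D.C k t : ℝ) ≤ -1 := by exact_mod_cast hC
  have h2' : (D.C t k : ℝ) ≤ -1 := by exact_mod_cast hC'
  have hk1 := D.one_le_d_real k
  have ht1 := D.one_le_d_real t
  have h3 : D.formAt k (ind T) ≤ -(D.d k : ℝ) := by nlinarith
  have h4 : D.formAt k (ind T) ≤ -(D.d t : ℝ) := by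
    rw [D.symm_real] at h1; nlinarith
  -- the quadratic polynomial in `s` is minimal at `s = max (d_k, d_t) / (2 d_k)`
  rcases D.two_mul_d_le hkt h hd with hle | hle
  · have hle' : 2 * (D.d k : ℝ) ≤ D.d t := by exact_mod_cast hle
    refine ⟨(D.d t : ℝ) / (2 * D.d k), by positivity, ?_⟩
    have e : 2 * (D.d k : ℝ) * ((D.d t : ℝ) / (2 * D.d k)) ^ 2
        = (D.d t : ℝ) * ((D.d t : ℝ) / (2 * D.d k)) := by field_simp
    rw [e]
    have hs : 1 ≤ (D.d t : ℝ) / (2 * D.d k) := by rw [le_div_iff₀ (by positivity)]; linarith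
    set s := (D.d t : ℝ) / (2 * D.d k)
    nlinarith
  · have hle' : 2 * (D.d t : ℝ) ≤ D.d k := by exact_mod_cast hle
    refine ⟨1 / 2, by norm_num, ?_⟩
    nlinarith

/-- A level set has at most one neighbour with another value of `d`: with two of them the form
would not be positive. -/
theorem neighbour_unique {T : Finset I} {e : ℕ} (hT : ∀ t ∈ T, D.d t = e) (hne : T.Nonempty)
    (hq : D.form (ind T) ≤ 2 * (e : ℝ)) {k k' t t' : I} (hk : k ∉ T) (hk' : k' ∉ T)
    (ht : t ∈ T) (ht' : t' ∈ T) (h : D.C k t ≠ 0) (h' : D.C k' t' ≠ 0) (hd : D.d k ≠ e)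
    (hd' : D.d k' ≠ e) : k = k' := by
  by_contra hkk
  -- the form at the indicator of `T` is at most `2 e`, and each neighbour takes away `e`
  obtain ⟨s, hs, h1⟩ := D.exists_drop hk ht h (by rwa [hT t ht])
  obtain ⟨s', hs', h1'⟩ := D.exists_drop hk' ht' h' (by rwa [hT t' ht'])
  rw [hT t ht] at h1
  rw [hT t' ht'] at h1'
  have hpos : 0 < D.form (ind T + Pi.single k s + Pi.single k' s') := by
    apply D.form_pos
    intro h0
    obtain ⟨u, hu⟩ := hne
    have := congrFun h0 u
    have e1 : u ≠ k := by rintro rfl; exact hk hu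
    have e2 : u ≠ k' := by rintro rfl; exact hk' hu
    simp [ind, hu, e1, e2] at this
  rw [form_add_single, form_add_single, formAt_add, formAt_single] at hpos
  have h2 : (D.C k' k : ℝ) ≤ 0 := by exact_mod_cast D.offDiag k' k (Ne.symm hkk)
  have h3 : s' * ((D.d k' : ℝ) * (D.C k' k : ℝ) * s) ≤ 0 := by
    have : (D.d k' : ℝ) * (D.C k' k : ℝ) ≤ 0 := by nlinarith [D.one_le_d_real k']
    exact mul_nonpos_of_nonneg_of_nonpos hs' (mul_nonpos_of_nonpos_of_nonneg this hs)
  linarith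

/-- The symmetrizer takes at most two values. The smaller one is `1`, and if there are two, they occur
at the ends of an edge, so that their ratio is at most `3`. -/
theorem d_le_three (i : I) : D.d i ≤ 3 := by
  obtain ⟨j, hj⟩ := D.d_min
  by_contra hlt
  push Not at hlt
  obtain ⟨T, hiT, hTd, hTq, hTm⟩ := D.exists_level_set i
  -- the unique neighbour of `T`
  have hex : ∃ k ∉ T, ∃ t ∈ T, D.C k t ≠ 0 := by
    by_contra hno
    push Not at hno
    have := D.connected (↑T) ⟨i, hiT⟩ (fun t ht k hk => by
      by_contra hkT
      exact hk (D.C_eq_zero_comm (hno k hkT t ht)))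
    have hjT : j ∈ (T : Set I) := by rw [this]; trivial
    have := hTd j hjT
    omega
  obtain ⟨k, hkT, t, htT, hkt⟩ := hex
  have hkd : D.d k ≠ D.d i := fun h => hkt (hTm k hkT h t htT)
  obtain ⟨U, hkU, hUd, hUq, hUm⟩ := D.exists_level_set k
  -- `k` is the only neighbour of `T` and `t` the only neighbour of `U`, so `T ∪ U` is everything
  have htU : t ∉ U := fun h => hkd (by rw [← hUd t h, hTd t htT])
  have huniv := D.connected (↑T ∪ ↑U) ⟨i, Or.inl hiT⟩ (by
    rintro a (ha | ha) b hab
    · by_cases hb : b ∈ T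
      · exact Or.inl hb
      · right
        have hba : D.C b a ≠ 0 := fun h0 => hab (D.C_eq_zero_comm h0)
        have := D.neighbour_unique hTd ⟨i, hiT⟩ hTq hb hkT ha htT hba hkt
          (fun h => hba (hTm b hb h a ha)) hkd
        rw [this]; exact hkU
    · by_cases hb : b ∈ U
      · exact Or.inr hb
      · left
        have hba : D.C b a ≠ 0 := fun h0 => hab (D.C_eq_zero_comm h0)
        have := D.neighbour_unique hUd ⟨k, hkU⟩ hUq hb htU ha hkU hba
          (fun h0 => hkt (D.C_eq_zero_comm h0))
          (fun h => hba (hUm b hb h a ha)) (by rw [hTd t htT]; exact Ne.symm hkd)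
        rw [this]; exact htT)
  have hjm : j ∈ (↑T ∪ ↑U : Set I) := by rw [huniv]; trivial
  have htk : t ≠ k := by rintro rfl; exact hkT htT
  have h3 := D.d_le_three_mul htk (fun h0 => hkt (D.C_eq_zero_comm h0))
  rw [hTd t htT] at h3
  rcases hjm with hj' | hj'
  · have := hTd j hj'; omega
  · have := hUd j hj'; omega

/-- For an edge whose first entry is `-1`, either the symmetrizer is constant along the edge or its
smaller value is `1`. -/
theorem edge_d {i j : I} (hij : i ≠ j) (h : D.C i j = -1) :
    D.d i = D.d j * (D.C j i).natAbs ∧ ((D.C j i).natAbs = 1 ∨ D.d j = 1) := by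
  have hs := D.symm i j
  have h0 := D.offDiag j i hij.symm
  rw [h] at hs
  have h1 : D.d i = D.d j * (D.C j i).natAbs := by
    zify
    rw [abs_of_nonpos h0]
    linarith
  refine ⟨h1, ?_⟩
  have h2 := D.d_le_three i
  have h3 := D.d_pos i
  have h4 := D.d_pos j
  by_contra hcon
  push Not at hcon
  have h5 : (D.C j i).natAbs ≠ 0 := by intro h; rw [h, mul_zero] at h1; omega
  have h6 : 2 ≤ (D.C j i).natAbs := by have := hcon.1; omega
  have h7 : 2 ≤ D.d j := by have := hcon.2; omega
  nlinarith

end CartanDatum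

/-! ### The deformed Cartan matrix -/

section Deformed

variable {I : Type*} [Fintype I] [DecidableEq I] (D : CartanDatum I)

/-- The evaluation `∑_e a_e f(e)` of the Laurent polynomial `∑_e a_e z^e` that is the `(k,i)` entry
of the deformed Cartan matrix. -/
def qsum {M : Type*} [AddCommGroup M] (k i : I) (f : ℤ → M) : M :=
  if k = i then f (D.d i) + f (-(D.d i : ℤ))
  else -∑ r ∈ Finset.range (D.C k i).natAbs, f ((D.C k i).natAbs - 1 - 2 * (r : ℤ))

theorem map_qsum {M N : Type*} [AddCommGroup M] [AddCommGroup N] (g : M →+ N) (k i : I)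
    (f : ℤ → M) : g (qsum D k i f) = qsum D k i fun e => g (f e) := by
  unfold qsum
  split_ifs <;> simp

theorem qsum_add {M : Type*} [AddCommGroup M] (k i : I) (f g : ℤ → M) :
    qsum D k i (fun e => f e + g e) = qsum D k i f + qsum D k i g := by
  unfold qsum
  split_ifs
  · exact add_add_add_comm _ _ _ _
  · rw [Finset.sum_add_distrib, neg_add]

theorem qsum_sub {M : Type*} [AddCommGroup M] (k i : I) (f g : ℤ → M) :
    qsum D k i (fun e => f e - g e) = qsum D k i f - qsum D k i g := by
  unfold qsum
  split_ifs
  · rw [add_sub_add_comm]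
  · rw [Finset.sum_sub_distrib, neg_sub_neg, neg_sub]

/-- The entries of the deformed Cartan matrix are invariant under `z ↦ z⁻¹`. -/
theorem qsum_neg {M : Type*} [AddCommGroup M] (k i : I) (f : ℤ → M) :
    qsum D k i (fun e => f (-e)) = qsum D k i f := by
  unfold qsum
  split_ifs
  · simp only [neg_neg]; exact add_comm _ _
  · congr 1
    rw [← Finset.sum_range_reflect]
    refine Finset.sum_congr rfl fun r hr => ?_
    have := Finset.mem_range.mp hr
    change f (-_) = f _
    congr 1
    omega

theorem deformedC_eq_qsum (k i : I) :
    deformedC D k i = qsum D k i fun e => HahnSeries.single e (1 : ℤ) := by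
  unfold deformedC qsum
  by_cases h : k = i
  · subst h; simp
  · have h0 := D.offDiag k i h
    rw [if_neg h, if_neg h]
    unfold qInt
    rcases h0.lt_or_eq with h1 | h1
    · rw [Int.sign_eq_neg_one_of_neg h1, neg_one_smul]
    · simp [h1]

theorem A_eq_qsum (i : I) (p : ℤ) :
    A D (i, p) = ∑ k, qsum D k i fun e => Y (k, p + e) := by
  unfold A
  rw [← Finset.add_sum_erase _ _ (Finset.mem_univ i)]
  have h1 : qsum D i i (fun e => Y (i, p + e)) = Y (i, p - D.d i) + Y (i, p + D.d i) := by
    simp only [qsum, if_true]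
    rw [add_comm]; rfl
  rw [h1, sub_eq_add_neg, ← Finset.sum_neg_distrib]
  congr 1
  refine Finset.sum_congr rfl fun k hk => ?_
  rw [qsum, if_neg (Finset.ne_of_mem_erase hk)]

theorem coeff_deformedC_mul (k i : I) (x : LaurentSeries ℤ) (u : ℤ) :
    (deformedC D k i * x).coeff u = qsum D k i fun e => x.coeff (u - e) := by
  have h : ∀ y : LaurentSeries ℤ, (y * x).coeff u
      = ((HahnSeries.coeff.addMonoidHom u).comp (AddMonoidHom.mulRight x)) y := fun y => rfl
  rw [h, deformedC_eq_qsum, map_qsum]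
  congr 1
  funext e
  rw [← h, HahnSeries.coeff_single_mul, one_mul]

theorem z_mul_z (a b : ℤ) : (HahnSeries.single a (1 : ℤ) : LaurentSeries ℤ) * HahnSeries.single b 1
    = HahnSeries.single (a + b) 1 := by
  rw [HahnSeries.single_mul_single, mul_one]

/-- `(z - z⁻¹) [n]_z = z^n - z^{-n}`. -/
theorem telescope (n : ℕ) :
    (HahnSeries.single 1 (1 : ℤ) - HahnSeries.single (-1) 1 : LaurentSeries ℤ)
      * ∑ r ∈ Finset.range n, HahnSeries.single ((n : ℤ) - 1 - 2 * (r : ℤ)) 1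
    = HahnSeries.single (n : ℤ) 1 - HahnSeries.single (-(n : ℤ)) 1 := by
  rw [Finset.mul_sum]
  have h : ∀ r ∈ Finset.range n, (HahnSeries.single 1 (1 : ℤ) - HahnSeries.single (-1) 1 :
        LaurentSeries ℤ) * HahnSeries.single ((n : ℤ) - 1 - 2 * (r : ℤ)) 1
      = HahnSeries.single ((n : ℤ) - 2 * (r : ℤ)) 1
        - HahnSeries.single ((n : ℤ) - 2 * ((r + 1 : ℕ) : ℤ)) 1 := by
    intro r _
    rw [sub_mul, z_mul_z, z_mul_z]
    congr 2
    · ring_nf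
    · push_cast; ring_nf
  rw [Finset.sum_congr rfl h,
    Finset.sum_range_sub' (fun r : ℕ => (HahnSeries.single ((n : ℤ) - 2 * (r : ℤ)) (1 : ℤ) :
      LaurentSeries ℤ))]
  rw [show (n : ℤ) - 2 * ((0 : ℕ) : ℤ) = n by simp, show (n : ℤ) - 2 * (n : ℤ) = -n by ring]

/-- `z^{d_i} - z^{-d_i}`. -/
noncomputable def zdiff (i : I) : LaurentSeries ℤ :=
  HahnSeries.single (D.d i : ℤ) 1 - HahnSeries.single (-(D.d i : ℤ)) 1

theorem zdiff_mul_deformedC_of_edge {k i : I} (hki : k ≠ i) (h : D.C k i = -1) :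
    zdiff D k * deformedC D k i = zdiff D i * deformedC D i k := by
  obtain ⟨hd, h1⟩ := D.edge_d hki h
  have hc : D.C i k ≠ 0 := by
    intro h0
    rw [h0] at hd
    have := D.d_pos k
    simp at hd; omega
  have e1 : deformedC D k i = -1 := by
    rw [deformedC_eq_qsum, qsum, if_neg hki, h]
    simp
  have e2 : deformedC D i k = -∑ r ∈ Finset.range (D.C i k).natAbs,
      HahnSeries.single (((D.C i k).natAbs : ℤ) - 1 - 2 * (r : ℤ)) 1 := by
    rw [deformedC_eq_qsum, qsum, if_neg hki.symm]
  rw [e1, e2]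
  rcases h1 with h1 | h1
  · have : D.d k = D.d i := by rw [hd, h1, mul_one]
    rw [h1, zdiff, zdiff, this]
    simp
  · have hk : D.d k = (D.C i k).natAbs := by rw [hd, h1, one_mul]
    have e3 : zdiff D i = HahnSeries.single 1 (1 : ℤ) - HahnSeries.single (-1) 1 := by
      rw [zdiff, h1]; rfl
    rw [mul_neg_one, e3, mul_neg, telescope, zdiff, hk]

/-- The matrix `(z^{d_i} - z^{-d_i}) C_{ij}(z)` is symmetric. -/
theorem zdiff_mul_deformedC (k i : I) :
    zdiff D k * deformedC D k i = zdiff D i * deformedC D i k := by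
  by_cases hki : k = i
  · rw [hki]
  by_cases h : D.C k i = 0
  · have h' := D.C_eq_zero_comm h
    rw [deformedC_eq_qsum, deformedC_eq_qsum, qsum, qsum, if_neg hki, if_neg (Ne.symm hki), h, h']
    simp
  rcases D.edge_cases hki h with ⟨h1, -⟩ | ⟨h1, -⟩
  · exact zdiff_mul_deformedC_of_edge D hki h1
  · exact (zdiff_mul_deformedC_of_edge D (Ne.symm hki) h1).symm

/-- After multiplication of its columns by the `z^{d_j}` the deformed Cartan matrix has entries in
`ℤ⟦z⟧` and is the identity at `z = 0`. -/
theorem isUnit_det_deformedC : IsUnit (deformedC D).det := by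
  let N : Matrix I I (PowerSeries ℤ) := fun i j =>
    if i = j then 1 + PowerSeries.X ^ (2 * D.d j)
    else -∑ r ∈ Finset.range (D.C i j).natAbs,
      PowerSeries.X ^ (((D.C i j).natAbs : ℤ) - 1 - 2 * (r : ℤ) + D.d j).toNat
  have hexp : ∀ i j, i ≠ j → ∀ r ∈ Finset.range (D.C i j).natAbs,
      0 < ((D.C i j).natAbs : ℤ) - 1 - 2 * (r : ℤ) + D.d j := by
    intro i j hij r hr
    have hr' := Finset.mem_range.mp hr
    have hne : D.C i j ≠ 0 := by intro h; simp [h] at hr'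
    have hdj := D.d_pos j
    have hdi := D.d_pos i
    rcases D.edge_cases hij hne with ⟨h1, -⟩ | ⟨-, h1, h2, -⟩
    · rw [h1] at hr' ⊢
      simp at hr' ⊢
      omega
    · have : ((D.C i j).natAbs : ℤ) ≤ D.d j := by
        rw [h2, Int.natCast_natAbs, abs_of_neg h1]
        nlinarith
      omega
  have hN : N.map (HahnSeries.ofPowerSeries ℤ ℤ)
      = deformedC D * Matrix.diagonal fun j => HahnSeries.single (D.d j : ℤ) (1 : ℤ) := by
    ext1 i j
    rw [Matrix.mul_diagonal, Matrix.map_apply, deformedC_eq_qsum]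
    simp only [N, qsum]
    by_cases hij : i = j
    · rw [if_pos hij, if_pos hij, add_mul, z_mul_z, z_mul_z, map_add, map_one,
        HahnSeries.ofPowerSeries_X_pow]
      rw [add_comm]
      congr 1
      · rw [Nat.cast_mul, Nat.cast_two, two_mul]
      · simp
    · rw [if_neg hij, if_neg hij, map_neg, map_sum, neg_mul, Finset.sum_mul]
      congr 1
      refine Finset.sum_congr rfl fun r hr => ?_
      have := hexp i j hij r hr
      rw [HahnSeries.ofPowerSeries_X_pow, z_mul_z, Int.toNat_of_nonneg this.le]
  have hdet : PowerSeries.constantCoeff N.det = 1 := by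
    rw [RingHom.map_det]
    have : (PowerSeries.constantCoeff (R := ℤ)).mapMatrix N = 1 := by
      ext i j
      rw [RingHom.mapMatrix_apply, Matrix.map_apply]
      simp only [N]
      by_cases hij : i = j
      · subst hij
        have := D.d_pos i
        simp
        omega
      · rw [if_neg hij, Matrix.one_apply_ne hij, map_neg, map_sum, neg_eq_zero]
        refine Finset.sum_eq_zero fun r hr => ?_
        have := hexp i j hij r hr
        rw [map_pow, PowerSeries.constantCoeff_X, zero_pow]
        omega
    rw [this, Matrix.det_one]
  have hu : IsUnit N.det := by
    rw [PowerSeries.isUnit_iff_constantCoeff, hdet]; exact isUnit_one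
  have h1 := hu.map (HahnSeries.ofPowerSeries ℤ ℤ)
  rw [RingHom.map_det, RingHom.mapMatrix_apply, hN, Matrix.det_mul] at h1
  exact isUnit_of_mul_isUnit_left h1

/-- The coefficients of `C(z) C(z)⁻¹ = 1`, with the factors `z^{d_k} - z^{-d_k}` of the form `γ`. -/
theorem sum_qsum_cInv (i j : I) (u : ℤ) :
    (∑ k, qsum D k i fun e => cInv D k j (u - e - D.d k) - cInv D k j (u - e + D.d k))
      = if i = j then (if u = D.d i then 1 else 0) - (if u = -(D.d i : ℤ) then 1 else 0) else 0 := by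
  have h1 : ∀ k, (qsum D k i fun e => cInv D k j (u - e - D.d k) - cInv D k j (u - e + D.d k))
      = (zdiff D i * (deformedC D i k * (deformedC D)⁻¹ k j)).coeff u := by
    intro k
    rw [← mul_assoc, ← zdiff_mul_deformedC, mul_comm (zdiff D k), mul_assoc, coeff_deformedC_mul]
    congr 1
    funext e
    rw [zdiff, sub_mul, HahnSeries.coeff_sub, HahnSeries.coeff_single_mul,
      HahnSeries.coeff_single_mul, one_mul, one_mul, sub_neg_eq_add]
    rfl
  have h2 : ∑ k, deformedC D i k * (deformedC D)⁻¹ k j = (1 : Matrix I I (LaurentSeries ℤ)) i j := by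
    rw [← Matrix.mul_apply, Matrix.mul_nonsing_inv _ (isUnit_det_deformedC D)]
  have h3 : ∑ k, (zdiff D i * (deformedC D i k * (deformedC D)⁻¹ k j)).coeff u
      = (zdiff D i * (1 : Matrix I I (LaurentSeries ℤ)) i j).coeff u := by
    rw [← h2, Finset.mul_sum]
    rw [HahnSeries.coeff_sum]
  rw [Finset.sum_congr rfl fun k _ => h1 k, h3]
  by_cases hij : i = j
  · subst hij
    rw [if_pos rfl, Matrix.one_apply_eq, mul_one, zdiff, HahnSeries.coeff_sub,
      HahnSeries.coeff_single, HahnSeries.coeff_single]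
    congr
  · simp [hij]

theorem sum_qsum_cInv_right (i j : I) (u : ℤ) :
    (∑ k, qsum D k i fun e => cInv D j k (u - e)) = if i = j ∧ u = 0 then 1 else 0 := by
  have h1 : ∀ k, (qsum D k i fun e => cInv D j k (u - e))
      = ((deformedC D)⁻¹ j k * deformedC D k i).coeff u := by
    intro k
    rw [mul_comm, coeff_deformedC_mul]; rfl
  have h2 : ∑ k, (deformedC D)⁻¹ j k * deformedC D k i = (1 : Matrix I I (LaurentSeries ℤ)) j i := by
    rw [← Matrix.mul_apply, Matrix.nonsing_inv_mul _ (isUnit_det_deformedC D)]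
  rw [Finset.sum_congr rfl fun k _ => h1 k]
  have h3 : ∑ k, ((deformedC D)⁻¹ j k * deformedC D k i).coeff u
      = ((1 : Matrix I I (LaurentSeries ℤ)) j i).coeff u := by
    rw [← h2]
    rw [HahnSeries.coeff_sum]
  rw [h3]
  by_cases hij : i = j
  · subst hij
    simp [HahnSeries.coeff_one]
  · simp [hij, Ne.symm hij]

end Deformed

/-! ### The form `γ` on the monomials `A_{i,p}` -/

section Pairing

variable {I : Type*} [Fintype I] [DecidableEq I] (D : CartanDatum I)

/-- The form `γ` as a biadditive map. -/
noncomputable def gammaHom : Mon I →+ Mon I →+ ℤ :=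
  AddMonoidHom.mk' (fun m => AddMonoidHom.mk' (gamma D m) (gamma_add_right D m))
    fun m n => AddMonoidHom.ext fun k => gamma_add_left D m n k

theorem gammaHom_apply (m n : Mon I) : gammaHom D m n = gamma D m n := rfl

theorem gamma_sub_left (m n k : Mon I) : gamma D (m - n) k = gamma D m k - gamma D n k := by
  rw [← gammaHom_apply, map_sub]; rfl

theorem gamma_sub_right (m n k : Mon I) : gamma D m (n - k) = gamma D m n - gamma D m k :=
  (gammaHom D m).map_sub n k

theorem gamma_Y_Y (x y : I × ℤ) : gamma D (Y x) (Y y) = gammaY D x.1 y.1 (x.2 - y.2) := by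
  simp [gamma, Y]

theorem gamma_Y_A (j : I) (s : ℤ) (i : I) (p : ℤ) : gamma D (Y (j, s)) (A D (i, p))
    = 2 * (Y (j, s) (i, p + D.d i) - Y (j, s) (i, p - D.d i)) := by
  rw [A_eq_qsum, ← gammaHom_apply, map_sum]
  simp only [map_qsum, gammaHom_apply, gamma_Y_Y]
  have h : ∀ k, (qsum D k i fun e => gammaY D j k (s - (p + e)))
      = (qsum D k i fun e => cInv D j k (s - p - D.d j - e))
        - (qsum D k i fun e => cInv D j k (s - p + D.d j - e))
        - (qsum D k i fun e => cInv D j k (p - s - D.d j - e))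
        + (qsum D k i fun e => cInv D j k (p - s + D.d j - e)) := by
    intro k
    rw [← qsum_neg D k i (fun e => cInv D j k (p - s - D.d j - e)),
      ← qsum_neg D k i (fun e => cInv D j k (p - s + D.d j - e)), ← qsum_sub, ← qsum_sub,
      ← qsum_add]
    congr 1
    funext e
    unfold gammaY
    ring_nf
  rw [Finset.sum_congr rfl fun k _ => h k]
  simp only [Finset.sum_add_distrib, Finset.sum_sub_distrib, sum_qsum_cInv_right]
  simp only [Y, Finsupp.single_apply, Prod.mk.injEq]
  have hd := D.d_pos i
  by_cases hij : i = j
  · subst hij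
    simp only [true_and]
    split_ifs <;> omega
  · have : j ≠ i := fun h => hij h.symm
    simp [hij, this]

theorem gamma_A_Y (j : I) (s : ℤ) (i : I) (p : ℤ) : gamma D (A D (i, p)) (Y (j, s))
    = 2 * (Y (j, s) (i, p - D.d i) - Y (j, s) (i, p + D.d i)) := by
  have h0 : ∀ x, gamma D x (Y (j, s)) = (gammaHom D).flip (Y (j, s)) x := fun x => rfl
  rw [A_eq_qsum, h0, map_sum]
  simp only [map_qsum]
  simp only [← h0, gamma_Y_Y]
  have h : ∀ k, (qsum D k i fun e => gammaY D k j (p + e - s))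
      = (qsum D k i fun e => cInv D k j (p - s - e - D.d k) - cInv D k j (p - s - e + D.d k))
        - (qsum D k i fun e => cInv D k j (s - p - e - D.d k) - cInv D k j (s - p - e + D.d k)) := by
    intro k
    rw [← qsum_neg D k i (fun e => cInv D k j (p - s - e - D.d k) - cInv D k j (p - s - e + D.d k)),
      ← qsum_sub]
    congr 1
    funext e
    unfold gammaY
    ring_nf
  rw [Finset.sum_congr rfl fun k _ => h k]
  simp only [Finset.sum_sub_distrib, sum_qsum_cInv]
  simp only [Y, Finsupp.single_apply, Prod.mk.injEq]
  have hd := D.d_pos i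
  by_cases hij : i = j
  · subst hij
    simp only [true_and, if_true]
    split_ifs <;> omega
  · have : j ≠ i := fun h => hij h.symm
    simp [hij, this]

/-- The form `γ` pairs a monomial with `A_{i,p}` through two of its exponents. -/
theorem gamma_A_right (m : Mon I) (i : I) (p : ℤ) :
    gamma D m (A D (i, p)) = 2 * (m (i, p + D.d i) - m (i, p - D.d i)) := by
  induction m using Finsupp.induction_linear with
  | zero => simp [gamma_zero_left]
  | add f g hf hg => rw [gamma_add_left, hf, hg]; simp; ring
  | single x a =>
    have h1 : (Finsupp.single x a : Mon I) = a • Y x := by simp [Y]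
    rw [h1, ← gammaHom_apply, map_zsmul, AddMonoidHom.smul_apply, gammaHom_apply, gamma_Y_A]
    simp; ring

theorem gamma_A_left (m : Mon I) (i : I) (p : ℤ) :
    gamma D (A D (i, p)) m = 2 * (m (i, p - D.d i) - m (i, p + D.d i)) := by
  induction m using Finsupp.induction_linear with
  | zero => simp [gamma_zero_right]
  | add f g hf hg => rw [gamma_add_right, hf, hg]; simp; ring
  | single x a =>
    have h1 : (Finsupp.single x a : Mon I) = a • Y x := by simp [Y]
    rw [h1, ← gammaHom_apply, map_zsmul, gammaHom_apply, gamma_A_Y]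
    simp; ring

theorem gamma_A_eq_neg (m : Mon I) (x : I × ℤ) : gamma D (A D x) m = -gamma D m (A D x) := by
  rw [gamma_A_left, gamma_A_right]; ring

end Pairing

/-! ### Coefficients of elements of the quantum torus -/

namespace IsIntegralPow

theorem zero : IsIntegralPow 0 := fun n h => by simp at h

theorem add {a b : Coef} (ha : IsIntegralPow a) (hb : IsIntegralPow b) : IsIntegralPow (a + b) := by
  intro n h
  by_cases h1 : a.coeff n = 0
  · refine hb n fun h2 => h ?_
    rw [AddMonoidAlgebra.coeff_add, Finsupp.add_apply, h1, h2, add_zero]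
  · exact ha n h1

theorem neg {a : Coef} (ha : IsIntegralPow a) : IsIntegralPow (-a) := fun n h =>
  ha n fun h1 => h (by rw [AddMonoidAlgebra.coeff_neg, Finsupp.neg_apply, h1, neg_zero])

theorem mul {a b : Coef} (ha : IsIntegralPow a) (hb : IsIntegralPow b) : IsIntegralPow (a * b) := by
  intro n h
  by_contra hn
  apply h
  rw [AddMonoidAlgebra.coeff_mul]
  refine Finset.sum_eq_zero fun x hx => Finset.sum_eq_zero fun y hy => ?_
  dsimp only
  rw [if_neg]
  rintro rfl
  exact hn ((ha x (Finsupp.mem_support_iff.mp hx)).add (hb y (Finsupp.mem_support_iff.mp hy)))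

theorem T_two_mul (n : ℤ) : IsIntegralPow (LaurentPolynomial.T (2 * n)) := by
  intro k h
  rw [LaurentPolynomial.T_apply] at h
  split_ifs at h with hk
  · rw [← hk]; exact even_two_mul n
  · exact absurd rfl h

theorem one : IsIntegralPow 1 := by
  have := T_two_mul 0
  rwa [mul_zero, LaurentPolynomial.T_zero] at this

theorem sum {α : Type*} (s : Finset α) (f : α → Coef) (h : ∀ x ∈ s, IsIntegralPow (f x)) :
    IsIntegralPow (∑ x ∈ s, f x) := by
  classical
  induction s using Finset.induction_on with
  | empty => simpa using zero
  | insert a s ha ih =>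
    rw [Finset.sum_insert ha]
    exact (h a (Finset.mem_insert_self _ _)).add
      (ih fun x hx => h x (Finset.mem_insert_of_mem hx))

end IsIntegralPow

theorem T_mul_eq_zero {k : ℤ} {a : Coef} : LaurentPolynomial.T k * a = 0 ↔ a = 0 :=
  (LaurentPolynomial.isUnit_T k).mul_right_eq_zero

namespace QTorus

variable {I : Type*} [Fintype I] [DecidableEq I] {D : CartanDatum I}

theorem ext {f g : QTorus D} (h : ∀ m, f m = g m) : f = g := DFunLike.ext (F := Mon I →₀ Coef) _ _ h

theorem zero_apply (m : Mon I) : (0 : QTorus D) m = 0 := rfl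

theorem add_apply (f g : QTorus D) (m : Mon I) : (f + g) m = f m + g m := Finsupp.add_apply _ _ _

theorem sub_apply (f g : QTorus D) (m : Mon I) : (f - g) m = f m - g m := Finsupp.sub_apply _ _ _

theorem smul_apply (a : Coef) (f : QTorus D) (m : Mon I) : (a • f) m = a * f m :=
  Finsupp.smul_apply a f m

theorem sum_apply {α : Type*} (s : Finset α) (f : α → QTorus D) (m : Mon I) :
    (∑ x ∈ s, f x) m = ∑ x ∈ s, f x m :=
  Finsupp.finsetSum_apply s f m

/-- The finite set of monomials occurring in an element of the quantum torus. -/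
def support (f : QTorus D) : Finset (Mon I) := Finsupp.support (M := Coef) f

theorem mem_support {f : QTorus D} {m : Mon I} : m ∈ f.support ↔ f m ≠ 0 := Finsupp.mem_support_iff

theorem mono_mul_mono_one (m n : Mon I) : mono D m 1 * mono D n 1
    = (LaurentPolynomial.T (gamma D m n) : Coef) • mono D (m + n) 1 := by
  rw [mono_mul_mono, smul_mono]; simp

end QTorus

/-! ### Monomials in the `A_{i,p}` -/

section Roots

variable {I : Type*} [Fintype I] [DecidableEq I] (D : CartanDatum I)

theorem Aprod_zero : Aprod D 0 = 0 := Finsupp.sum_zero_index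

theorem Aprod_add (v w : RootExp I) : Aprod D (v + w) = Aprod D v + Aprod D w :=
  Finsupp.sum_add_index' (fun _ => zero_smul _ _) fun _ _ _ => add_smul _ _ _

theorem Aprod_single (x : I × ℤ) (n : ℕ) : Aprod D (Finsupp.single x n) = n • A D x :=
  Finsupp.sum_single_index (zero_smul _ _)

theorem gamma_Aprod_eq_neg (v : RootExp I) (m : Mon I) :
    gamma D (Aprod D v) m = -gamma D m (Aprod D v) := by
  induction v using Finsupp.induction_linear with
  | zero => simp [Aprod_zero, gamma_zero_left, gamma_zero_right]
  | add f g hf hg => rw [Aprod_add, gamma_add_left, gamma_add_right, hf, hg]; ring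
  | single x n =>
    rw [Aprod_single, ← gammaHom_apply, ← gammaHom_apply, map_nsmul, map_nsmul,
      AddMonoidHom.smul_apply, gammaHom_apply, gammaHom_apply, gamma_A_eq_neg, smul_neg]

theorem gamma_Y_Aprod (i : I) (s : ℤ) (v : RootExp I) : gamma D (Y (i, s)) (Aprod D v)
    = 2 * ((v (i, s - D.d i) : ℤ) - v (i, s + D.d i)) := by
  induction v using Finsupp.induction_linear with
  | zero => simp [Aprod_zero, gamma_zero_right]
  | add f g hf hg =>
    rw [Aprod_add, gamma_add_right, hf, hg]
    simp only [Finsupp.add_apply]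
    push_cast
    ring
  | single x n =>
    obtain ⟨j, p⟩ := x
    rw [Aprod_single, ← gammaHom_apply, map_nsmul, gammaHom_apply, gamma_A_right]
    simp only [Y, Finsupp.single_apply, Prod.mk.injEq, nsmul_eq_mul]
    have hd := D.d_pos j
    by_cases hij : i = j
    · subst hij
      simp only [true_and]
      split_ifs <;> omega
    · have : j ≠ i := fun h => hij h.symm
      simp [hij, this]

/-- The `A_{i,p}` are multiplicatively independent, because the form `γ` separates them. -/
theorem Aprod_injective : Function.Injective (Aprod D) := by
  intro v w h
  have hper : ∀ i s, (v (i, s + 2 * D.d i) : ℤ) - w (i, s + 2 * D.d i) = v (i, s) - w (i, s) := by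
    intro i s
    have h1 := gamma_Y_Aprod D i (s + D.d i) v
    have h2 := gamma_Y_Aprod D i (s + D.d i) w
    rw [h, h2] at h1
    rw [show s + (D.d i : ℤ) - D.d i = s by ring,
      show s + (D.d i : ℤ) + D.d i = s + 2 * D.d i by ring] at h1
    linarith
  have hper' : ∀ i s, ∀ n : ℕ, (v (i, s + n * (2 * D.d i)) : ℤ) - w (i, s + n * (2 * D.d i))
      = v (i, s) - w (i, s) := by
    intro i s n
    induction n with
    | zero => simp
    | succ n ih =>
      rw [← ih, ← hper i (s + n * (2 * D.d i))]
      push_cast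
      rw [show s + ((n : ℤ) + 1) * (2 * D.d i) = s + n * (2 * D.d i) + 2 * D.d i by ring]
  ext ⟨i, s⟩
  -- the periodic function `v - w` has finite support
  have hinj : Function.Injective fun n : ℕ => ((i, s + n * (2 * D.d i)) : I × ℤ) := by
    intro a b hab
    simp only [Prod.mk.injEq, true_and, add_right_inj] at hab
    have := D.d_pos i
    have h2 : (2 * (D.d i : ℤ)) ≠ 0 := by omega
    exact_mod_cast mul_right_cancel₀ h2 hab
  obtain ⟨n, hn⟩ := Set.Infinite.exists_notMem_finset
    (Set.infinite_range_of_injective hinj) (v.support ∪ w.support)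
  obtain ⟨⟨k, rfl⟩, hk⟩ := hn
  rw [Finset.mem_union, not_or, Finsupp.notMem_support_iff, Finsupp.notMem_support_iff] at hk
  have := hper' i s k
  dsimp only at hk
  rw [hk.1, hk.2] at this
  omega

theorem sub_Aprod_injective (m : Mon I) : Function.Injective fun v => m - Aprod D v :=
  fun _ _ h => Aprod_injective D (sub_right_injective h)

theorem A_apply_same (i : I) (p s : ℤ) :
    A D (i, p) (i, s) = (Y (i, p - D.d i) + Y (i, p + D.d i) : Mon I) (i, s) := by
  unfold A
  rw [Finsupp.sub_apply, Finsupp.finsetSum_apply, sub_eq_self]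
  refine Finset.sum_eq_zero fun j hj => ?_
  rw [Finsupp.finsetSum_apply]
  refine Finset.sum_eq_zero fun k _ => ?_
  simp [Y, Finset.ne_of_mem_erase hj]

theorem A_apply_of_ne {i j : I} (hij : j ≠ i) (p s : ℤ) : A D (i, p) (j, s) ≤ 0 := by
  unfold A
  rw [Finsupp.sub_apply, Finsupp.finsetSum_apply]
  have h1 : (Y (i, p - D.d i) + Y (i, p + D.d i) : Mon I) (j, s) = 0 := by
    simp [Y, hij.symm]
  rw [h1, zero_sub, neg_nonpos]
  refine Finset.sum_nonneg fun k _ => ?_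
  rw [Finsupp.finsetSum_apply]
  refine Finset.sum_nonneg fun r _ => ?_
  rw [Y, Finsupp.single_apply]
  split_ifs <;> simp

/-- The family of multiplicities of the `A_{i,p}` with `i` fixed, as a family over all nodes. -/
noncomputable def col (i : I) (v : ℤ →₀ ℕ) : RootExp I := v.mapDomain (Prod.mk i)

/-- The monomial `∏_p A_{i,p}^{v(p)}`. -/
noncomputable def Acol (i : I) (v : ℤ →₀ ℕ) : Mon I := v.sum fun p n => n • A D (i, p)

theorem Aprod_col (i : I) (v : ℤ →₀ ℕ) : Aprod D (col i v) = Acol D i v :=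
  Finsupp.sum_mapDomain_index (fun _ => zero_smul _ _) fun _ _ _ => add_smul _ _ _

theorem Acol_zero (i : I) : Acol D i 0 = 0 := Finsupp.sum_zero_index

theorem Acol_add (i : I) (v w : ℤ →₀ ℕ) : Acol D i (v + w) = Acol D i v + Acol D i w :=
  Finsupp.sum_add_index' (fun _ => zero_smul _ _) fun _ _ _ => add_smul _ _ _

theorem Acol_single (i : I) (p : ℤ) (n : ℕ) : Acol D i (Finsupp.single p n) = n • A D (i, p) :=
  Finsupp.sum_single_index (zero_smul _ _)

omit [Fintype I] [DecidableEq I] in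
theorem col_injective (i : I) : Function.Injective (col i) :=
  Finsupp.mapDomain_injective (Prod.mk_right_injective i)

theorem Acol_injective (i : I) : Function.Injective (Acol D i) := by
  intro v w h
  rw [← Aprod_col, ← Aprod_col] at h
  exact col_injective i (Aprod_injective D h)

theorem sub_Acol_injective (i : I) (m : Mon I) : Function.Injective fun v => m - Acol D i v :=
  fun _ _ h => Acol_injective D i (sub_right_injective h)

/-- The multiset of the `s` with `Y_{i,s}` occurring in `∏_p A_{i,p}^{v(p)}`, for `d = d_i`. -/
def rootWeight (d : ℕ) (v : ℤ →₀ ℕ) : Multiset ℤ :=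
  v.sum fun p n => n • ({p - d, p + d} : Multiset ℤ)

theorem rootWeight_zero (d : ℕ) : rootWeight d 0 = 0 := Finsupp.sum_zero_index

theorem rootWeight_add (d : ℕ) (v w : ℤ →₀ ℕ) :
    rootWeight d (v + w) = rootWeight d v + rootWeight d w :=
  Finsupp.sum_add_index' (fun _ => zero_smul _ _) fun _ _ _ => add_smul _ _ _

theorem rootWeight_single (d : ℕ) (p : ℤ) (n : ℕ) :
    rootWeight d (Finsupp.single p n) = n • ({p - d, p + d} : Multiset ℤ) :=
  Finsupp.sum_single_index (zero_smul _ _)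

theorem count_rootWeight (d : ℕ) (v : ℤ →₀ ℕ) (s : ℤ) :
    (rootWeight d v).count s = v (s - d) + v (s + d) := by
  induction v using Finsupp.induction_linear with
  | zero => simp [rootWeight_zero]
  | add f g hf hg => rw [rootWeight_add, Multiset.count_add, hf, hg]; simp; ring
  | single p n =>
    rw [rootWeight_single, Multiset.count_nsmul]
    simp only [Multiset.insert_eq_cons, Multiset.count_cons, Multiset.count_singleton,
      Finsupp.single_apply, mul_add, mul_ite, mul_one, mul_zero]
    congr 1 <;> congr 1 <;> rw [eq_iff_iff] <;> omega

theorem card_rootWeight_pos (d : ℕ) {v : ℤ →₀ ℕ} (hv : v ≠ 0) : 0 < (rootWeight d v).card := by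
  rw [Multiset.card_pos]
  intro h
  apply hv
  ext p
  have := count_rootWeight d v (p + d)
  rw [h, Multiset.count_zero, add_sub_cancel_right] at this
  rw [Finsupp.zero_apply]
  omega

/-- The monomial `∏_{p ∈ s} Y_{i,p}`. -/
noncomputable def Ycol (i : I) (s : Multiset ℤ) : Mon I := (s.map fun p => Y (i, p)).sum

/-- No `Y_{i,p}` occurs in the monomial. -/
def IsFree (i : I) (m : Mon I) : Prop := ∀ p, m (i, p) = 0

omit [Fintype I] [DecidableEq I] in
theorem Ycol_zero (i : I) : Ycol i 0 = 0 := rfl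

omit [Fintype I] [DecidableEq I] in
theorem Ycol_cons (i : I) (p : ℤ) (s : Multiset ℤ) : Ycol i (p ::ₘ s) = Y (i, p) + Ycol i s := by
  simp [Ycol]

omit [Fintype I] [DecidableEq I] in
theorem Ycol_add (i : I) (s t : Multiset ℤ) : Ycol i (s + t) = Ycol i s + Ycol i t := by
  simp [Ycol]

omit [Fintype I] [DecidableEq I] in
theorem Ycol_apply (i : I) (s : Multiset ℤ) (p : ℤ) : Ycol i s (i, p) = s.count p := by
  classical
  induction s using Multiset.induction_on with
  | empty => simp [Ycol_zero]
  | cons a s ih =>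
    rw [Ycol_cons, Finsupp.add_apply, ih, Multiset.count_cons, Y, Finsupp.single_apply]
    by_cases h : a = p
    · subst h; simp [add_comm]
    · simp [h, Ne.symm h]

omit [Fintype I] [DecidableEq I] in
theorem IsFree.add {i : I} {m n : Mon I} (hm : IsFree i m) (hn : IsFree i n) : IsFree i (m + n) :=
  fun p => by rw [Finsupp.add_apply, hm p, hn p, add_zero]

omit [Fintype I] [DecidableEq I] in
theorem isFree_zero (i : I) : IsFree i (0 : Mon I) := fun _ => rfl

theorem Acol_apply (i : I) (v : ℤ →₀ ℕ) (s : ℤ) :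
    Acol D i v (i, s) = (rootWeight (D.d i) v).count s := by
  induction v using Finsupp.induction_linear with
  | zero => simp [Acol_zero, rootWeight_zero]
  | add f g hf hg =>
    rw [Acol_add, rootWeight_add, Multiset.count_add, Finsupp.add_apply, hf, hg]; push_cast; ring
  | single p n =>
    have h : (Y (i, p - D.d i) + Y (i, p + D.d i) : Mon I) = Ycol i {p - D.d i, p + D.d i} := by
      simp [Ycol]
    rw [Acol_single, rootWeight_single, Multiset.count_nsmul, Finsupp.smul_apply, A_apply_same, h,
      Ycol_apply, nsmul_eq_mul, Nat.cast_mul]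

theorem isFree_Ycol_sub_Acol (i : I) (v : ℤ →₀ ℕ) :
    IsFree i (Ycol i (rootWeight (D.d i) v) - Acol D i v) := fun p => by
  rw [Finsupp.sub_apply, Ycol_apply, Acol_apply, sub_self]

omit [Fintype I] [DecidableEq I] in
/-- An `i`-dominant monomial is a product of variables `Y_{i,p}` times a monomial in the others. -/
theorem exists_Ycol_of_isDomAt {i : I} {m : Mon I} (hm : IsDomAt i m) :
    ∃ s : Multiset ℤ, ∃ z, IsFree i z ∧ m = Ycol i s + z := by
  classical
  let a : ℤ →₀ ℤ := m.comapDomain (Prod.mk i) (Prod.mk_right_injective i).injOn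
  let b : ℤ →₀ ℕ := a.mapRange Int.toNat rfl
  refine ⟨Finsupp.toMultiset b, m - Ycol i (Finsupp.toMultiset b), fun p => ?_, by abel⟩
  rw [Finsupp.sub_apply, Ycol_apply, Finsupp.count_toMultiset]
  have : ((b p : ℕ) : ℤ) = m (i, p) := Int.toNat_of_nonneg (hm p)
  rw [this, sub_self]

omit [Fintype I] [DecidableEq I] in
theorem isDomAt_Ycol_add {i : I} {s : Multiset ℤ} {z : Mon I} (hz : IsFree i z) :
    IsDomAt i (Ycol i s + z) := fun p => by
  rw [Finsupp.add_apply, Ycol_apply, hz p]; positivity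

theorem isDomAt_sub_Acol {i : I} {s : Multiset ℤ} {z : Mon I} (hz : IsFree i z) (v : ℤ →₀ ℕ) :
    IsDomAt i (Ycol i s + z - Acol D i v) ↔ rootWeight (D.d i) v ≤ s := by
  rw [Multiset.le_iff_count]
  refine forall_congr' fun p => ?_
  rw [Finsupp.sub_apply, Finsupp.add_apply, Ycol_apply, Acol_apply, hz p]
  omega

omit [Fintype I] [DecidableEq I] in
theorem Ycol_add_injective {i : I} {s t : Multiset ℤ} {y z : Mon I} (hy : IsFree i y)
    (hz : IsFree i z) (h : Ycol i s + y = Ycol i t + z) : s = t ∧ y = z := by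
  have hs : s = t := by
    ext p
    have := DFunLike.congr_fun h (i, p)
    rw [Finsupp.add_apply, Finsupp.add_apply, Ycol_apply, Ycol_apply, hy p, hz p] at this
    simpa using this
  exact ⟨hs, by rw [hs] at h; exact add_left_cancel h⟩

theorem gamma_Acol_of_isFree {i : I} {z : Mon I} (hz : IsFree i z) (v : ℤ →₀ ℕ) :
    gamma D (Acol D i v) z = 0 := by
  rw [← Aprod_col, gamma_Aprod_eq_neg, Aprod_col, neg_eq_zero]
  induction v using Finsupp.induction_linear with
  | zero => simp [Acol_zero, gamma_zero_right]
  | add f g hf hg => rw [Acol_add, gamma_add_right, hf, hg, add_zero]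
  | single p n =>
    rw [Acol_single, ← gammaHom_apply, map_nsmul, gammaHom_apply, gamma_A_right, hz, hz]
    simp

end Roots

/-! ### Words in the generators of `K_{i,t}` -/

section Words

variable {I : Type*} [Fintype I] [DecidableEq I] (D : CartanDatum I)

/-- The generator `Y_{i,p} (1 + A_{i,p+d_i}⁻¹)` of `K_{i,t}`. -/
noncomputable def Xgen (i : I) (p : ℤ) : QTorus D :=
  QTorus.mono D (Y (i, p)) 1 + QTorus.mono D (Y (i, p) - A D (i, p + D.d i)) 1

/-- The product of the generators `Y_{i,p} (1 + A_{i,p+d_i}⁻¹)` with `p` in `L` and of the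
monomial `z`, which is meant to involve no `Y_{i,p}`. -/
noncomputable def word (i : I) (L : List ℤ) (z : Mon I) : QTorus D :=
  (L.map (Xgen D i)).prod * QTorus.mono D z 1

theorem gamma_A_right_of_isFree {i : I} {z : Mon I} (hz : IsFree i z) (p : ℤ) :
    gamma D z (A D (i, p)) = 0 := by
  rw [gamma_A_right, hz, hz]; simp

theorem gamma_A_left_of_isFree {i : I} {z : Mon I} (hz : IsFree i z) (p : ℤ) :
    gamma D (A D (i, p)) z = 0 := by
  rw [gamma_A_left, hz, hz]; simp

theorem mono_mul_Xgen {i : I} {z : Mon I} (hz : IsFree i z) (p : ℤ) :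
    QTorus.mono D z 1 * Xgen D i p
      = (LaurentPolynomial.T (gamma D z (Y (i, p)) - gamma D (Y (i, p)) z) : Coef) •
        (Xgen D i p * QTorus.mono D z 1) := by
  unfold Xgen
  rw [mul_add, add_mul, smul_add]
  simp only [QTorus.mono_mul_mono_one, smul_smul, ← LaurentPolynomial.T_add]
  rw [gamma_sub_right, gamma_sub_left, gamma_A_right_of_isFree D hz, gamma_A_left_of_isFree D hz,
    add_comm z, add_comm z]
  simp

theorem mono_mul_prod_Xgen {i : I} {z : Mon I} (hz : IsFree i z) (L : List ℤ) : ∃ k : ℤ,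
    QTorus.mono D z 1 * (L.map (Xgen D i)).prod
      = (LaurentPolynomial.T k : Coef) • ((L.map (Xgen D i)).prod * QTorus.mono D z 1) := by
  induction L with
  | nil => exact ⟨0, by simp⟩
  | cons p L ih =>
    obtain ⟨k, hk⟩ := ih
    refine ⟨gamma D z (Y (i, p)) - gamma D (Y (i, p)) z + k, ?_⟩
    rw [List.map_cons, List.prod_cons, ← mul_assoc, mono_mul_Xgen D hz, smul_mul_assoc, mul_assoc,
      hk, mul_smul_comm, smul_smul, LaurentPolynomial.T_add, mul_assoc]

theorem mono_mul_word {i : I} {z : Mon I} (hz : IsFree i z) (L : List ℤ) (z' : Mon I) : ∃ k : ℤ,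
    QTorus.mono D z 1 * word D i L z'
      = (LaurentPolynomial.T k : Coef) • word D i L (z + z') := by
  obtain ⟨k, hk⟩ := mono_mul_prod_Xgen D hz L
  refine ⟨k + gamma D z z', ?_⟩
  unfold word
  rw [← mul_assoc, hk, smul_mul_assoc, mul_assoc, QTorus.mono_mul_mono_one, mul_smul_comm,
    smul_smul, LaurentPolynomial.T_add]

theorem word_mul_word {i : I} (L L' : List ℤ) {z : Mon I} (hz : IsFree i z) (z' : Mon I) :
    ∃ k : ℤ, word D i L z * word D i L' z'
      = (LaurentPolynomial.T k : Coef) • word D i (L ++ L') (z + z') := by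
  obtain ⟨k, hk⟩ := mono_mul_word D hz L' z'
  refine ⟨k, ?_⟩
  nth_rewrite 1 [word]
  rw [mul_assoc, hk, mul_smul_comm, word, ← mul_assoc, ← List.prod_append, ← List.map_append, word]

theorem Xgen_mul_word (i : I) (p : ℤ) (L : List ℤ) (z : Mon I) :
    Xgen D i p * word D i L z = word D i (p :: L) z := by
  rw [word, word, List.map_cons, List.prod_cons, mul_assoc]

omit [Fintype I] in
theorem Y_apply_same (i : I) (p s : ℤ) : (Y (i, p) : Mon I) (i, s) = if p = s then 1 else 0 := by
  simp [Y, Finsupp.single_apply]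

theorem Xgen_mul_Xgen (i : I) (p s : ℤ) : Xgen D i p * Xgen D i s
    = (LaurentPolynomial.T (gamma D (Y (i, p)) (Y (i, s))) : Coef) •
      (QTorus.mono D (Y (i, p) + Y (i, s)) 1
      + (LaurentPolynomial.T (2 * ((if s = p then 1 else 0) - if p = s + 2 * D.d i then 1 else 0)) :
          Coef) • QTorus.mono D (Y (i, p) + Y (i, s) - A D (i, s + D.d i)) 1
      + (LaurentPolynomial.T (2 * ((if s = p + 2 * D.d i then 1 else 0) - if s = p then 1 else 0)) :
          Coef) • QTorus.mono D (Y (i, p) + Y (i, s) - A D (i, p + D.d i)) 1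
      + QTorus.mono D (Y (i, p) + Y (i, s) - A D (i, p + D.d i) - A D (i, s + D.d i)) 1) := by
  have hd := D.d_pos i
  have h1 : gamma D (Y (i, p)) (A D (i, s + D.d i))
      = 2 * ((if p = s + 2 * D.d i then 1 else 0) - if s = p then 1 else 0) := by
    rw [gamma_A_right, Y_apply_same, Y_apply_same]
    split_ifs <;> omega
  have h2 : gamma D (A D (i, p + D.d i)) (Y (i, s))
      = 2 * ((if s = p then 1 else 0) - if s = p + 2 * D.d i then 1 else 0) := by
    rw [gamma_A_left, Y_apply_same, Y_apply_same]
    split_ifs <;> omega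
  have h3 : gamma D (A D (i, p + D.d i)) (A D (i, s + D.d i))
      = 2 * ((if p = s + 2 * D.d i then 1 else 0) - if s = p + 2 * D.d i then 1 else 0) := by
    rw [gamma_A_right, A_apply_same, A_apply_same, Finsupp.add_apply, Finsupp.add_apply,
      Y_apply_same, Y_apply_same, Y_apply_same, Y_apply_same]
    split_ifs <;> omega
  unfold Xgen
  simp only [add_mul, mul_add, QTorus.mono_mul_mono_one, smul_add, smul_smul,
    ← LaurentPolynomial.T_add, gamma_sub_left, gamma_sub_right, h1, h2, h3]
  rw [← add_sub_assoc, sub_add_eq_add_sub, sub_add_sub_comm, ← sub_sub, ← add_assoc]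
  generalize (if s = p then (1 : ℤ) else 0) = x
  generalize (if s = p + 2 * D.d i then (1 : ℤ) else 0) = y
  generalize (if p = s + 2 * D.d i then (1 : ℤ) else 0) = z
  generalize gamma D (Y (i, p)) (Y (i, s)) = g
  rw [show g - 2 * (x - y) - (2 * (z - x) - 2 * (z - y)) = g by ring,
    show g - 2 * (z - x) = g + 2 * (x - z) by ring, show g - 2 * (x - y) = g + 2 * (y - x) by ring]
  rw [add_right_comm ((LaurentPolynomial.T g : Coef) • QTorus.mono D (Y (i, p) + Y (i, s)) 1)]

theorem smul_sum_four_eq {R M : Type*} [CommRing R] [AddCommGroup M] [Module R M]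
    (u t₁ t₂ s₁ s₂ : R) (m₁ m₂ m₃ m₄ : M) :
    u • (m₁ + t₁ • m₂ + t₂ • m₃ + m₄)
      = u • (m₁ + s₁ • m₃ + s₂ • m₂ + m₄) + (u * (t₁ - s₂)) • m₂ + (u * (t₂ - s₁)) • m₃ := by
  module

/-- Two generators commute up to a power of `t` and a multiple of a monomial in the other
variables. -/
theorem Xgen_swap (i : I) (p s : ℤ) : ∃ (k : ℤ) (b : Coef) (z : Mon I), IsFree i z ∧
    Xgen D i p * Xgen D i s
      = (LaurentPolynomial.T k : Coef) • (Xgen D i s * Xgen D i p) + b • QTorus.mono D z 1 := by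
  have hd := D.d_pos i
  have hfree : ∀ p s : ℤ, s = p + 2 * D.d i →
      IsFree i (Y (i, p) + Y (i, s) - A D (i, p + D.d i)) := by
    intro p s h q
    rw [Finsupp.sub_apply, A_apply_same, h, show p + (D.d i : ℤ) - D.d i = p by ring,
      show p + (D.d i : ℤ) + D.d i = p + 2 * D.d i by ring, sub_self]
  by_cases h1 : s = p
  · subst h1
    exact ⟨0, 0, 0, isFree_zero i, by simp⟩
  have h1' : p ≠ s := Ne.symm h1
  have hcomm : (Y (i, s) + Y (i, p) : Mon I) = Y (i, p) + Y (i, s) := add_comm _ _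
  have hE := Xgen_mul_Xgen D i p s
  have hE' := Xgen_mul_Xgen D i s p
  rw [hcomm, sub_right_comm] at hE'
  rw [smul_sum_four_eq _ _ _ (LaurentPolynomial.T (2 * ((if p = s then 1 else 0)
      - if s = p + 2 * D.d i then 1 else 0)))
    (LaurentPolynomial.T (2 * ((if p = s + 2 * D.d i then 1 else 0) - if p = s then 1 else 0))),
    ← sub_add_cancel (gamma D (Y (i, p)) (Y (i, s))) (gamma D (Y (i, s)) (Y (i, p))),
    LaurentPolynomial.T_add, mul_smul, ← hE', if_neg h1, if_neg h1'] at hE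
  by_cases h2 : s = p + 2 * D.d i
  · have h3 : p ≠ s + 2 * D.d i := by omega
    rw [if_pos h2, if_neg h3, sub_self (LaurentPolynomial.T _), mul_zero, zero_smul,
      add_zero] at hE
    exact ⟨_, _, _, hfree p s h2, hE⟩
  by_cases h3 : p = s + 2 * D.d i
  · have hf := hfree s p h3
    rw [hcomm] at hf
    rw [if_neg h2, if_pos h3, sub_self (LaurentPolynomial.T (2 * (0 - 0))), mul_zero, zero_smul,
      add_zero] at hE
    exact ⟨_, _, _, hf, hE⟩
  · rw [if_neg h2, if_neg h3, sub_self (LaurentPolynomial.T _), mul_zero, zero_smul,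
      add_zero, zero_smul, add_zero] at hE
    exact ⟨_, 0, 0, isFree_zero i, by rw [hE, zero_smul, add_zero]⟩

/-- The span of the words with fewer than `n` letters. -/
noncomputable def shortWords (i : I) (n : ℕ) : Submodule Coef (QTorus D) :=
  Submodule.span Coef {x | ∃ L z, L.length < n ∧ IsFree i z ∧ x = word D i L z}

theorem word_mem_shortWords {i : I} {L : List ℤ} {z : Mon I} {n : ℕ} (hL : L.length < n)
    (hz : IsFree i z) : word D i L z ∈ shortWords D i n :=
  Submodule.subset_span ⟨L, z, hL, hz, rfl⟩

theorem shortWords_mono (i : I) {n n' : ℕ} (h : n ≤ n') : shortWords D i n ≤ shortWords D i n' :=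
  Submodule.span_mono fun _ ⟨L, z, hL, hz, hx⟩ => ⟨L, z, hL.trans_le h, hz, hx⟩

theorem Xgen_mul_mem_shortWords {i : I} (p : ℤ) {n : ℕ} {x : QTorus D} (hx : x ∈ shortWords D i n) :
    Xgen D i p * x ∈ shortWords D i (n + 1) := by
  induction hx using Submodule.span_induction with
  | mem x h =>
    obtain ⟨L, z, hL, hz, rfl⟩ := h
    rw [Xgen_mul_word]
    exact word_mem_shortWords D (by simpa using hL) hz
  | zero => rw [mul_zero]; exact zero_mem _
  | add x y _ _ hx hy => rw [mul_add]; exact add_mem hx hy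
  | smul a x _ hx => rw [mul_smul_comm]; exact Submodule.smul_mem _ _ hx

/-- Permuting the letters of a word multiplies it by a power of `t`, up to shorter words. -/
theorem word_perm {i : I} {L L' : List ℤ} (h : L.Perm L') {z : Mon I} (hz : IsFree i z) :
    ∃ k : ℤ, word D i L z - (LaurentPolynomial.T k : Coef) • word D i L' z
      ∈ shortWords D i L.length := by
  induction h with
  | nil => exact ⟨0, by simp⟩
  | cons p _ ih =>
    obtain ⟨k, hk⟩ := ih
    refine ⟨k, ?_⟩
    rw [← Xgen_mul_word, ← Xgen_mul_word, ← mul_smul_comm, ← mul_sub]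
    exact Xgen_mul_mem_shortWords D p hk
  | swap p s L =>
    obtain ⟨k, b, z', hz', h⟩ := Xgen_swap D i s p
    obtain ⟨k', hk'⟩ := mono_mul_word D hz' L z
    refine ⟨k, ?_⟩
    rw [← Xgen_mul_word, ← Xgen_mul_word, ← Xgen_mul_word, ← Xgen_mul_word, ← mul_assoc,
      ← mul_assoc, h, add_mul, smul_mul_assoc, add_sub_cancel_left, smul_mul_assoc, hk']
    refine Submodule.smul_mem _ _ (Submodule.smul_mem _ _ (word_mem_shortWords D ?_ (hz'.add hz)))
    simp
  | trans h₁ _ ih₁ ih₂ =>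
    obtain ⟨k₁, hk₁⟩ := ih₁
    obtain ⟨k₂, hk₂⟩ := ih₂
    refine ⟨k₁ + k₂, ?_⟩
    rw [← h₁.length_eq] at hk₂
    have := add_mem hk₁ (Submodule.smul_mem _ (LaurentPolynomial.T k₁ : Coef) hk₂)
    rwa [smul_sub, smul_smul, ← LaurentPolynomial.T_add, sub_add_sub_cancel] at this

/-- The span of the words with letters in a fixed order for each multiset of letters. -/
noncomputable def orderedWords (i : I) : Submodule Coef (QTorus D) :=
  Submodule.span Coef
    (Set.range fun a : Multiset ℤ × {z : Mon I // IsFree i z} => word D i a.1.toList a.2)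

theorem shortWords_le_orderedWords (i : I) (n : ℕ) : shortWords D i n ≤ orderedWords D i := by
  induction n with
  | zero =>
    refine Submodule.span_le.mpr ?_
    rintro x ⟨L, z, hL, -⟩
    exact absurd hL (Nat.not_lt_zero _)
  | succ n ih =>
    refine Submodule.span_le.mpr ?_
    rintro x ⟨L, z, hL, hz, rfl⟩
    have hp : L.Perm (L : Multiset ℤ).toList := by
      rw [← Multiset.coe_eq_coe, Multiset.coe_toList]
    obtain ⟨k, hk⟩ := word_perm D hp hz
    have h1 := ih (shortWords_mono D i (Nat.lt_succ_iff.mp hL) hk)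
    have h2 : word D i (L : Multiset ℤ).toList z ∈ orderedWords D i :=
      Submodule.subset_span ⟨(↑L, ⟨z, hz⟩), rfl⟩
    have := add_mem h1 (Submodule.smul_mem _ (LaurentPolynomial.T k : Coef) h2)
    rwa [sub_add_cancel] at this

theorem word_mem_orderedWords {i : I} (L : List ℤ) {z : Mon I} (hz : IsFree i z) :
    word D i L z ∈ orderedWords D i :=
  shortWords_le_orderedWords D i _ (word_mem_shortWords D (Nat.lt_succ_self _) hz)

omit [Fintype I] [DecidableEq I] in
theorem isFree_Y {i j : I} (hji : j ≠ i) (s : ℤ) : IsFree i (Y (j, s) : Mon I) := fun p => by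
  simp [Y, hji]

omit [Fintype I] [DecidableEq I] in
theorem IsFree.neg {i : I} {z : Mon I} (hz : IsFree i z) : IsFree i (-z) := fun p => by
  rw [Finsupp.neg_apply, hz p, neg_zero]

theorem word_nil (i : I) (z : Mon I) : word D i [] z = QTorus.mono D z 1 := by
  simp [word]

theorem Ki_le_orderedWords {i : I} {x : QTorus D} (hx : x ∈ Ki D i) : x ∈ orderedWords D i := by
  induction hx using Algebra.adjoin_induction with
  | mem x h =>
    rcases h with ⟨p, rfl⟩ | ⟨j, s, hj, rfl | rfl⟩
    · have := word_mem_orderedWords D (i := i) [p] (isFree_zero i)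
      rw [← Xgen_mul_word, word_nil] at this
      have h1 : QTorus.mono D 0 1 = (1 : QTorus D) := rfl
      rwa [h1, mul_one] at this
    · rw [← word_nil D i]
      exact word_mem_orderedWords D [] (isFree_Y hj s)
    · rw [← word_nil D i]
      exact word_mem_orderedWords D [] (isFree_Y hj s).neg
  | algebraMap r =>
    rw [Algebra.algebraMap_eq_smul_one]
    have h1 : (1 : QTorus D) = word D i [] 0 := (word_nil D i 0).symm
    rw [h1]
    exact Submodule.smul_mem _ _ (word_mem_orderedWords D [] (isFree_zero i))
  | add x y _ _ hx hy => exact add_mem hx hy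
  | mul x y hx' hy' hx hy =>
    clear hx' hy'
    induction hx using Submodule.span_induction with
    | mem x h =>
      obtain ⟨⟨s, z, hz⟩, rfl⟩ := h
      induction hy using Submodule.span_induction with
      | mem y h =>
        obtain ⟨⟨s', z', hz'⟩, rfl⟩ := h
        obtain ⟨k, hk⟩ := word_mul_word D s.toList s'.toList hz z'
        dsimp only
        rw [hk]
        exact Submodule.smul_mem _ _ (word_mem_orderedWords D _ (hz.add hz'))
      | zero => rw [mul_zero]; exact zero_mem _
      | add x y _ _ hx hy => rw [mul_add]; exact add_mem hx hy
      | smul a x _ hx => rw [mul_smul_comm]; exact Submodule.smul_mem _ _ hx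
    | zero => rw [zero_mul]; exact zero_mem _
    | add x y _ _ hx hy => rw [add_mul]; exact add_mem hx hy
    | smul a x _ hx => rw [smul_mul_assoc]; exact Submodule.smul_mem _ _ hx

theorem mono_mem_Ki_of_T_smul {i : I} {k : ℤ} {x : QTorus D}
    (h : (LaurentPolynomial.T k : Coef) • x ∈ Ki D i) : x ∈ Ki D i := by
  have := (Ki D i).smul_mem h (LaurentPolynomial.T (-k))
  rwa [smul_smul, ← LaurentPolynomial.T_add, neg_add_cancel, LaurentPolynomial.T_zero,
    one_smul] at this

theorem mono_add_mem_Ki {i : I} {m n : Mon I} (hm : QTorus.mono D m 1 ∈ Ki D i)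
    (hn : QTorus.mono D n 1 ∈ Ki D i) : QTorus.mono D (m + n) 1 ∈ Ki D i := by
  have := mul_mem hm hn
  rw [QTorus.mono_mul_mono_one] at this
  exact mono_mem_Ki_of_T_smul D this

theorem mono_mem_Ki {i : I} {z : Mon I} (hz : IsFree i z) : QTorus.mono D z 1 ∈ Ki D i := by
  induction z using Finsupp.induction with
  | zero => exact one_mem (Ki D i)
  | single_add x b f hx hb ih =>
    obtain ⟨j, s⟩ := x
    have hji : j ≠ i := by
      rintro rfl
      have := hz s
      rw [Finsupp.add_apply, Finsupp.single_eq_same, Finsupp.notMem_support_iff.mp hx,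
        add_zero] at this
      exact hb this
    have h1 : IsFree i (Finsupp.single (j, s) b : Mon I) := fun p => by simp [hji]
    refine mono_add_mem_Ki D ?_ (ih fun p => ?_)
    · have hp : QTorus.mono D (Y (j, s)) 1 ∈ Ki D i :=
        Algebra.subset_adjoin (Or.inr ⟨j, s, hji, Or.inl rfl⟩)
      have hn : QTorus.mono D (-Y (j, s)) 1 ∈ Ki D i :=
        Algebra.subset_adjoin (Or.inr ⟨j, s, hji, Or.inr rfl⟩)
      have hsmul : (Finsupp.single (j, s) b : Mon I) = b • Y (j, s) := by simp [Y]
      rw [hsmul]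
      clear hsmul hx hb h1 hz
      induction b using Int.induction_on with
      | zero => rw [zero_smul]; exact one_mem (Ki D i)
      | succ n ih => rw [add_smul, one_smul]; exact mono_add_mem_Ki D ih hp
      | pred n ih => rw [sub_smul, one_smul, sub_eq_add_neg]; exact mono_add_mem_Ki D ih hn
    · have := hz p
      rwa [Finsupp.add_apply, h1 p, zero_add] at this

theorem word_mem_Ki {i : I} (L : List ℤ) {z : Mon I} (hz : IsFree i z) : word D i L z ∈ Ki D i := by
  refine mul_mem (list_prod_mem fun x hx => ?_) (mono_mem_Ki D hz)
  obtain ⟨p, -, rfl⟩ := List.mem_map.mp hx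
  exact Algebra.subset_adjoin (Or.inl ⟨p, rfl⟩)

end Words

/-! ### The coefficients of words -/

section WordCoef

/-- Left multiplication by `Y_{i,p} (1 + A_{i,p+d}⁻¹)`, up to a power of `t`, of
`∑_v c(v) m ∏_q A_{i,q}^{-v(q)}`, in terms of the coefficients `c(v)`. Only `d = d_i` and the
multiset `L` of the `q` with `Y_{i,q}` occurring in `m` matter. The three summands of the exponents
are `-γ(Y_{i,p}, A^v)`, `-γ(A_{i,p+d}, m)` and `γ(A_{i,p+d}, A^v)`, where `A^v = ∏_q A_{i,q}^{v(q)}`;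
the factor `t^{γ(Y_{i,p}, m)/2}` is left out. -/
noncomputable def letterStep (d : ℕ) (p : ℤ) (L : List ℤ) :
    ((ℤ →₀ ℕ) →₀ Coef) →ₗ[Coef] ((ℤ →₀ ℕ) →₀ Coef) :=
  Finsupp.linearCombination Coef fun v =>
    Finsupp.single v (LaurentPolynomial.T (2 * ((v (p + d) : ℤ) - v (p - d))))
    + Finsupp.single (v + Finsupp.single (p + d) 1) (LaurentPolynomial.T
      (2 * ((v (p + d) : ℤ) - v (p - d)) + 2 * ((L.count (p + 2 * d) : ℤ) - L.count p)
        + 2 * ((v (p - d) : ℤ) - v (p + 3 * d))))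

/-- The coefficient of `∏_p A_{i,p}^{-v(p)}` in the product of the generators of `K_{i,t}` attached
to the letters of a list, relative to the leading coefficient, for `d = d_i`. -/
noncomputable def wordCoef (d : ℕ) : List ℤ → ((ℤ →₀ ℕ) →₀ Coef)
  | [] => Finsupp.single 0 1
  | p :: L => letterStep d p L (wordCoef d L)

theorem letterStep_apply (d : ℕ) (p : ℤ) (L : List ℤ) (c : (ℤ →₀ ℕ) →₀ Coef) (w : ℤ →₀ ℕ) :
    letterStep d p L c w = ∑ v ∈ c.support, c v *
      ((if v = w then LaurentPolynomial.T (2 * ((v (p + d) : ℤ) - v (p - d))) else 0)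
      + (if v + Finsupp.single (p + d) 1 = w then LaurentPolynomial.T
      (2 * ((v (p + d) : ℤ) - v (p - d)) + 2 * ((L.count (p + 2 * d) : ℤ) - L.count p)
        + 2 * ((v (p - d) : ℤ) - v (p + 3 * d))) else 0)) := by
  rw [letterStep, Finsupp.linearCombination_apply, Finsupp.sum, Finsupp.finsetSum_apply]
  refine Finset.sum_congr rfl fun v _ => ?_
  rw [Finsupp.smul_apply, Finsupp.add_apply, Finsupp.single_apply, Finsupp.single_apply, smul_eq_mul]

theorem wordCoef_zero (d : ℕ) (L : List ℤ) : wordCoef d L 0 = 1 := by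
  induction L with
  | nil => simp [wordCoef]
  | cons p L ih =>
    rw [wordCoef, letterStep_apply, Finset.sum_eq_single 0]
    · simp [ih]
    · intro v _ hv
      have : v + Finsupp.single (p + d : ℤ) 1 ≠ 0 := fun h => hv (add_eq_zero.mp h).1
      simp [hv]
    · intro h
      rw [Finsupp.notMem_support_iff.mp h, zero_mul]

theorem isIntegralPow_wordCoef (d : ℕ) (L : List ℤ) (v : ℤ →₀ ℕ) :
    IsIntegralPow (wordCoef d L v) := by
  induction L generalizing v with
  | nil =>
    rw [wordCoef, Finsupp.single_apply]
    split_ifs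
    · exact IsIntegralPow.one
    · exact IsIntegralPow.zero
  | cons p L ih =>
    rw [wordCoef, letterStep_apply]
    refine IsIntegralPow.sum _ _ fun w _ => (ih w).mul (IsIntegralPow.add ?_ ?_)
    · split_ifs
      · exact IsIntegralPow.T_two_mul _
      · exact IsIntegralPow.zero
    · split_ifs
      · rw [← mul_add, ← mul_add]
        exact IsIntegralPow.T_two_mul _
      · exact IsIntegralPow.zero

end WordCoef

section Realize

variable {I : Type*} [Fintype I] [DecidableEq I] (D : CartanDatum I)

/-- The element `∑_v c(v) m ∏_p A_{i,p}^{-v(p)}` of the quantum torus. -/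
noncomputable def realize (i : I) (m : Mon I) : ((ℤ →₀ ℕ) →₀ Coef) →ₗ[Coef] QTorus D :=
  Finsupp.lmapDomain Coef Coef fun v => m - Acol D i v

theorem realize_single (i : I) (m : Mon I) (v : ℤ →₀ ℕ) (a : Coef) :
    realize D i m (Finsupp.single v a) = QTorus.mono D (m - Acol D i v) a :=
  Finsupp.mapDomain_single

theorem realize_apply (i : I) (m : Mon I) (c : (ℤ →₀ ℕ) →₀ Coef) (v : ℤ →₀ ℕ) :
    realize D i m c (m - Acol D i v) = c v :=
  Finsupp.mapDomain_apply (sub_Acol_injective D i m) c v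

theorem exists_of_realize_ne_zero {i : I} {m n : Mon I} {c : (ℤ →₀ ℕ) →₀ Coef}
    (h : realize D i m c n ≠ 0) : ∃ v, n = m - Acol D i v ∧ c v ≠ 0 := by
  classical
  have h1 : n ∈ (Finsupp.mapDomain (fun v => m - Acol D i v) c).support :=
    Finsupp.mem_support_iff.mpr h
  obtain ⟨v, hv, rfl⟩ := Finset.mem_image.mp (Finsupp.mapDomain_support h1)
  exact ⟨v, rfl, Finsupp.mem_support_iff.mp hv⟩

/-- Translation of the coefficients by `w`. -/
noncomputable def shift (w : ℤ →₀ ℕ) : ((ℤ →₀ ℕ) →₀ Coef) →ₗ[Coef] ((ℤ →₀ ℕ) →₀ Coef) :=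
  Finsupp.lmapDomain Coef Coef fun v => w + v

theorem shift_single (w v : ℤ →₀ ℕ) (a : Coef) :
    shift w (Finsupp.single v a) = Finsupp.single (w + v) a :=
  Finsupp.mapDomain_single

theorem shift_add_apply (w v : ℤ →₀ ℕ) (c : (ℤ →₀ ℕ) →₀ Coef) : shift w c (w + v) = c v :=
  Finsupp.mapDomain_apply (add_right_injective w) c v

theorem exists_of_shift_ne_zero {w u : ℤ →₀ ℕ} {c : (ℤ →₀ ℕ) →₀ Coef} (h : shift w c u ≠ 0) :
    ∃ v, u = w + v ∧ c v ≠ 0 := by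
  classical
  have h1 : u ∈ (Finsupp.mapDomain (fun v => w + v) c).support := Finsupp.mem_support_iff.mpr h
  obtain ⟨v, hv, rfl⟩ := Finset.mem_image.mp (Finsupp.mapDomain_support h1)
  exact ⟨v, rfl, Finsupp.mem_support_iff.mp hv⟩

theorem shift_shift (w w' : ℤ →₀ ℕ) (c : (ℤ →₀ ℕ) →₀ Coef) :
    shift w (shift w' c) = shift (w + w') c := by
  induction c using Finsupp.induction_linear with
  | zero => simp
  | add f g hf hg => simp only [map_add, hf, hg]
  | single v a => rw [shift_single, shift_single, shift_single, add_assoc]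

theorem shift_zero (c : (ℤ →₀ ℕ) →₀ Coef) : shift 0 c = c := by
  induction c using Finsupp.induction_linear with
  | zero => simp
  | add f g hf hg => simp only [map_add, hf, hg]
  | single v a => rw [shift_single, zero_add]

theorem realize_shift (i : I) (m : Mon I) (w : ℤ →₀ ℕ) (c : (ℤ →₀ ℕ) →₀ Coef) :
    realize D i m (shift w c) = realize D i (m - Acol D i w) c := by
  induction c using Finsupp.induction_linear with
  | zero => simp
  | add f g hf hg => simp only [map_add, hf, hg]
  | single v a => rw [shift_single, realize_single, realize_single, Acol_add, sub_sub]

theorem gamma_Y_Acol (i : I) (p : ℤ) (v : ℤ →₀ ℕ) :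
    gamma D (Y (i, p)) (Acol D i v) = 2 * ((v (p - D.d i) : ℤ) - v (p + D.d i)) := by
  rw [← Aprod_col, gamma_Y_Aprod, col]
  rw [Finsupp.mapDomain_apply (Prod.mk_right_injective i),
    Finsupp.mapDomain_apply (Prod.mk_right_injective i)]

theorem Xgen_mul_realize (i : I) (p : ℤ) (L : List ℤ) (c : (ℤ →₀ ℕ) →₀ Coef) :
    Xgen D i p * realize D i (Ycol i L) c
      = (LaurentPolynomial.T (gamma D (Y (i, p)) (Ycol i L)) : Coef) •
        realize D i (Ycol i (p :: L : List ℤ)) (letterStep (D.d i) p L c) := by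
  induction c using Finsupp.induction_linear with
  | zero => simp
  | add f g hf hg => simp only [map_add, mul_add, hf, hg, smul_add]
  | single v a =>
    have h1 : gamma D (A D (i, p + D.d i)) (Acol D i v)
        = 2 * ((v (p - D.d i) : ℤ) - v (p + 3 * D.d i)) := by
      rw [gamma_A_left, Acol_apply, Acol_apply, count_rootWeight, count_rootWeight,
        show p + (D.d i : ℤ) - D.d i = p by ring,
        show p + (D.d i : ℤ) + D.d i - D.d i = p + D.d i by ring,
        show p + (D.d i : ℤ) + D.d i + D.d i = p + 3 * D.d i by ring]
      push_cast
      ring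
    have h2 : gamma D (A D (i, p + D.d i)) (Ycol i L)
        = 2 * ((L.count p : ℤ) - L.count (p + 2 * D.d i)) := by
      rw [gamma_A_left, Ycol_apply, Ycol_apply, show p + (D.d i : ℤ) - D.d i = p by ring,
        show p + (D.d i : ℤ) + D.d i = p + 2 * D.d i by ring, Multiset.coe_count,
        Multiset.coe_count]
    have h3 : Ycol i ((p :: L : List ℤ) : Multiset ℤ) = Y (i, p) + Ycol i L := Ycol_cons i p ↑L
    rw [letterStep, Finsupp.linearCombination_single, map_smul, map_add, realize_single,
      realize_single, realize_single, Xgen, add_mul, QTorus.mono_mul_mono, QTorus.mono_mul_mono,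
      smul_add, smul_add, QTorus.smul_mono, QTorus.smul_mono, QTorus.smul_mono, QTorus.smul_mono,
      one_mul, gamma_sub_left, gamma_sub_right, gamma_sub_right, h1, h2, h3, gamma_Y_Acol,
      Acol_add, Acol_single, one_smul]
    rw [show Y (i, p) + (Ycol i L - Acol D i v) = Y (i, p) + Ycol i L - Acol D i v by abel,
      show Y (i, p) - A D (i, p + D.d i) + (Ycol i L - Acol D i v)
        = Y (i, p) + Ycol i L - (Acol D i v + A D (i, p + D.d i)) by abel]
    rw [mul_left_comm, mul_left_comm _ a, ← LaurentPolynomial.T_add, ← LaurentPolynomial.T_add]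
    have h4 : ∀ g x y z w u : ℤ, g - 2 * (x - y) - (2 * (z - w) - 2 * (x - u))
        = g + (2 * (y - x) + 2 * (w - z) + 2 * (x - u)) := fun g x y z w u => by ring
    have h5 : ∀ g x y : ℤ, g - 2 * (x - y) = g + 2 * (y - x) := fun g x y => by ring
    rw [h4, h5]

theorem prod_Xgen_eq_realize (i : I) (L : List ℤ) : ∃ k : ℤ, (L.map (Xgen D i)).prod
    = (LaurentPolynomial.T k : Coef) • realize D i (Ycol i L) (wordCoef (D.d i) L) := by
  induction L with
  | nil =>
    refine ⟨0, ?_⟩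
    rw [LaurentPolynomial.T_zero, one_smul, wordCoef, realize_single, Acol_zero, sub_zero]
    rfl
  | cons p L ih =>
    obtain ⟨k, hk⟩ := ih
    refine ⟨k + gamma D (Y (i, p)) (Ycol i L), ?_⟩
    rw [List.map_cons, List.prod_cons, hk, mul_smul_comm, Xgen_mul_realize, smul_smul,
      LaurentPolynomial.T_add, wordCoef]

theorem realize_mul_mono (i : I) (m : Mon I) {z : Mon I} (hz : IsFree i z)
    (c : (ℤ →₀ ℕ) →₀ Coef) : realize D i m c * QTorus.mono D z 1
      = (LaurentPolynomial.T (gamma D m z) : Coef) • realize D i (m + z) c := by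
  induction c using Finsupp.induction_linear with
  | zero => simp
  | add f g hf hg => simp only [map_add, add_mul, hf, hg, smul_add]
  | single v a =>
    rw [realize_single, realize_single, QTorus.mono_mul_mono, QTorus.smul_mono, gamma_sub_left,
      gamma_Acol_of_isFree D hz, sub_zero, mul_one, mul_comm, sub_add_eq_add_sub]

/-- Up to a power of `t`, the coefficients of a word only depend on `d_i` and the letters. -/
theorem word_eq_realize {i : I} (L : List ℤ) {z : Mon I} (hz : IsFree i z) : ∃ k : ℤ, word D i L z
    = (LaurentPolynomial.T k : Coef) • realize D i (Ycol i L + z) (wordCoef (D.d i) L) := by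
  obtain ⟨k, hk⟩ := prod_Xgen_eq_realize D i L
  refine ⟨k + gamma D (Ycol i L) z, ?_⟩
  rw [word, hk, smul_mul_assoc, realize_mul_mono D i _ hz, smul_smul, LaurentPolynomial.T_add]

theorem realize_wordCoef_mem_Ki {i : I} (L : List ℤ) {z : Mon I} (hz : IsFree i z) :
    realize D i (Ycol i L + z) (wordCoef (D.d i) L) ∈ Ki D i := by
  obtain ⟨k, hk⟩ := word_eq_realize D L hz
  have := word_mem_Ki D L hz
  rw [hk] at this
  exact mono_mem_Ki_of_T_smul D this

/-- A nonzero element of `K_{i,t}` contains an `i`-dominant monomial: the leading monomial of an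
ordered word in its expansion that has the greatest number of letters. -/
theorem eq_zero_of_no_isDomAt {i : I} {x : QTorus D} (hx : x ∈ Ki D i)
    (h : ∀ m, x m ≠ 0 → ¬ IsDomAt i m) : x = 0 := by
  obtain ⟨c, hc⟩ := Finsupp.mem_span_range_iff_exists_finsupp.mp (Ki_le_orderedWords D hx)
  by_cases hne : c.support.Nonempty
  · exfalso
    obtain ⟨⟨s, z, hz⟩, ha, hmax⟩ := c.support.exists_max_image (fun a => a.1.card) hne
    refine h (Ycol i s + z) ?_ (isDomAt_Ycol_add hz)
    rw [← hc, Finsupp.sum, QTorus.sum_apply, Finset.sum_eq_single (s, ⟨z, hz⟩)]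
    · obtain ⟨k, hk⟩ := word_eq_realize D s.toList hz
      have h1 := realize_apply D i (Ycol i s + z) (wordCoef (D.d i) s.toList) 0
      rw [Acol_zero, sub_zero, wordCoef_zero] at h1
      rw [QTorus.smul_apply, hk, QTorus.smul_apply, Multiset.coe_toList, h1, mul_one, mul_comm]
      exact fun h0 => Finsupp.mem_support_iff.mp ha (T_mul_eq_zero.mp h0)
    · rintro ⟨t, y, hy⟩ hb hab
      by_contra h0
      rw [QTorus.smul_apply] at h0
      obtain ⟨k, hk⟩ := word_eq_realize D t.toList hy
      rw [hk, QTorus.smul_apply] at h0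
      have h1 := right_ne_zero_of_mul (right_ne_zero_of_mul h0)
      obtain ⟨v, hv, -⟩ := exists_of_realize_ne_zero D h1
      rw [Multiset.coe_toList] at hv
      -- compare the exponents of the `Y_{i,p}`, the number of which drops along `v`
      have h2 : Ycol i t + y = Ycol i (s + rootWeight (D.d i) v)
          + (z - (Ycol i (rootWeight (D.d i) v) - Acol D i v)) := by
        rw [Ycol_add, eq_sub_iff_add_eq] at *
        rw [← hv]; abel
      obtain ⟨h3, h4⟩ := Ycol_add_injective hy
        (by rw [sub_eq_add_neg]; exact hz.add (isFree_Ycol_sub_Acol D i v).neg) h2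
      have h5 := hmax _ hb
      dsimp only at h5
      rw [h3, Multiset.card_add] at h5
      have hv0 : v = 0 := by
        by_contra hv0
        have := card_rootWeight_pos (D.d i) hv0
        omega
      subst hv0
      rw [rootWeight_zero, Ycol_zero, Acol_zero, sub_zero, sub_zero] at h4
      rw [rootWeight_zero, add_zero] at h3
      subst h3; subst h4
      exact hab rfl
    · intro h0; exact absurd ha h0
  · rw [Finset.not_nonempty_iff_eq_empty, Finsupp.support_eq_empty] at hne
    rw [← hc, hne, Finsupp.sum_zero_index]

end Realize

/-! ### The elements `F_{i,t}(m)` -/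

section Fit

/-- The combinations of the coefficient families of words whose leading terms lie in a fixed coset
`∏_{p ∈ s} Y_{i,p} ∏ A_{i,p}^{-v(p)}`. -/
noncomputable def wordSpan (d : ℕ) (s : Multiset ℤ) : Submodule Coef ((ℤ →₀ ℕ) →₀ Coef) :=
  Submodule.span Coef {c | ∃ w t, t + rootWeight d w = s ∧ c = shift w (wordCoef d t.toList)}

theorem shift_mem_wordSpan {d : ℕ} {s t : Multiset ℤ} {w : ℤ →₀ ℕ} (h : t + rootWeight d w = s)
    {c : (ℤ →₀ ℕ) →₀ Coef} (hc : c ∈ wordSpan d t) : shift w c ∈ wordSpan d s := by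
  induction hc using Submodule.span_induction with
  | mem c hc =>
    obtain ⟨w', t', ht', rfl⟩ := hc
    rw [shift_shift]
    refine Submodule.subset_span ⟨w + w', t', ?_, rfl⟩
    rw [rootWeight_add, ← h, ← ht']; abel
  | zero => rw [map_zero]; exact zero_mem _
  | add x y _ _ hx hy => rw [map_add]; exact add_mem hx hy
  | smul a x _ hx => rw [map_smul]; exact Submodule.smul_mem _ _ hx

/-- The coefficients of `F_{i,t}(m)`, obtained from those of a word by subtracting multiples of the
`F_{i,t}(m')` for the smaller `i`-dominant monomials `m'`. -/
theorem exists_fitCoef (d : ℕ) (s : Multiset ℤ) : ∃ c ∈ wordSpan d s, c 0 = 1 ∧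
    (∀ v, IsIntegralPow (c v)) ∧ ∀ v, c v ≠ 0 → rootWeight d v ≤ s → v = 0 := by
  classical
  induction h : s.card using Nat.strong_induction_on generalizing s with
  | _ N ih =>
    subst h
    set e := wordCoef d s.toList with he
    have hrec : ∀ w : ℤ →₀ ℕ, ∃ c : (ℤ →₀ ℕ) →₀ Coef, w ≠ 0 → rootWeight d w ≤ s →
        c ∈ wordSpan d (s - rootWeight d w) ∧ c 0 = 1 ∧ (∀ v, IsIntegralPow (c v)) ∧
        ∀ v, c v ≠ 0 → rootWeight d v ≤ s - rootWeight d w → v = 0 := by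
      intro w
      by_cases hw : w ≠ 0 ∧ rootWeight d w ≤ s
      · obtain ⟨c, h1, h2, h3, h4⟩ := ih (s - rootWeight d w).card (by
          rw [Multiset.card_sub hw.2]
          have := card_rootWeight_pos d hw.1
          have := Multiset.card_le_card hw.2
          omega) _ rfl
        exact ⟨c, fun _ _ => ⟨h1, h2, h3, h4⟩⟩
      · exact ⟨0, fun h1 h2 => absurd ⟨h1, h2⟩ hw⟩
    choose f hf using hrec
    -- `W` indexes the `i`-dominant monomials of the word other than the leading one
    let W := e.support.filter fun w => w ≠ 0 ∧ rootWeight d w ≤ s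
    have hW : ∀ w ∈ W, w ≠ 0 ∧ rootWeight d w ≤ s := fun w hw => (Finset.mem_filter.mp hw).2
    refine ⟨e - ∑ w ∈ W, e w • shift w (f w), ?_, ?_, ?_, ?_⟩
    · refine sub_mem (Submodule.subset_span ⟨0, s, ?_, ?_⟩) (sum_mem fun w hw => ?_)
      · rw [rootWeight_zero, add_zero]
      · rw [shift_zero]
      · exact Submodule.smul_mem _ _ (shift_mem_wordSpan (tsub_add_cancel_of_le (hW w hw).2)
          (hf w (hW w hw).1 (hW w hw).2).1)
    · rw [Finsupp.sub_apply, he, wordCoef_zero, Finsupp.finsetSum_apply, sub_eq_self]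
      refine Finset.sum_eq_zero fun w hw => ?_
      rw [Finsupp.smul_apply]
      by_contra h0
      obtain ⟨v, hv, -⟩ := exists_of_shift_ne_zero (right_ne_zero_of_mul h0)
      exact (hW w hw).1 (add_eq_zero.mp hv.symm).1
    · intro v
      rw [Finsupp.sub_apply, Finsupp.finsetSum_apply, sub_eq_add_neg]
      refine (isIntegralPow_wordCoef d _ v).add (IsIntegralPow.neg (IsIntegralPow.sum _ _ fun w hw => ?_))
      rw [Finsupp.smul_apply]
      refine (isIntegralPow_wordCoef d _ w).mul ?_
      by_cases h0 : shift w (f w) v = 0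
      · rw [h0]; exact IsIntegralPow.zero
      · obtain ⟨u, rfl, -⟩ := exists_of_shift_ne_zero h0
        rw [shift_add_apply]
        exact (hf w (hW w hw).1 (hW w hw).2).2.2.1 u
    · intro v hv hvs
      by_contra hv0
      apply hv
      rw [Finsupp.sub_apply, Finsupp.finsetSum_apply, sub_eq_zero]
      -- at an `i`-dominant monomial only the `F_{i,t}` with this leading monomial contributes
      have hother : ∀ w ∈ W, w ≠ v → (e w • shift w (f w)) v = 0 := by
        intro w hw hwv
        by_contra h0
        obtain ⟨u, rfl, hu⟩ := exists_of_shift_ne_zero (right_ne_zero_of_mul h0)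
        have := (hf w (hW w hw).1 (hW w hw).2).2.2.2 u hu (by
          rw [rootWeight_add] at hvs
          exact le_tsub_of_add_le_left hvs)
        exact hwv (by rw [this, add_zero])
      by_cases hve : v ∈ W
      · rw [Finset.sum_eq_single v hother fun h => absurd hve h, Finsupp.smul_apply]
        have := shift_add_apply v 0 (f v)
        rw [add_zero] at this
        rw [this, (hf v (hW v hve).1 (hW v hve).2).2.1, smul_eq_mul, mul_one]
      · rw [Finset.sum_eq_zero fun w hw => hother w hw (by rintro rfl; exact hve hw)]
        by_contra h0
        exact hve (Finset.mem_filter.mpr ⟨Finsupp.mem_support_iff.mpr h0, hv0, hvs⟩)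

/-- The coefficients of `F_{i,t}(m)` for `d = d_i` and `s` the multiset of the `p` with `Y_{i,p}`
occurring in `m`. -/
noncomputable def fitCoef (d : ℕ) (s : Multiset ℤ) : (ℤ →₀ ℕ) →₀ Coef := (exists_fitCoef d s).choose

theorem fitCoef_spec (d : ℕ) (s : Multiset ℤ) : fitCoef d s ∈ wordSpan d s ∧ fitCoef d s 0 = 1 ∧
    (∀ v, IsIntegralPow (fitCoef d s v)) ∧ ∀ v, fitCoef d s v ≠ 0 → rootWeight d v ≤ s → v = 0 :=
  (exists_fitCoef d s).choose_spec

variable {I : Type*} [Fintype I] [DecidableEq I] (D : CartanDatum I)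

theorem realize_mem_Ki {i : I} {s : Multiset ℤ} {z : Mon I} (hz : IsFree i z)
    {c : (ℤ →₀ ℕ) →₀ Coef} (hc : c ∈ wordSpan (D.d i) s) :
    realize D i (Ycol i s + z) c ∈ Ki D i := by
  induction hc using Submodule.span_induction with
  | mem c hc =>
    obtain ⟨w, t, rfl, rfl⟩ := hc
    rw [realize_shift]
    have h := realize_wordCoef_mem_Ki D t.toList
      (hz.add (isFree_Ycol_sub_Acol D i w))
    rw [Multiset.coe_toList] at h
    have e : Ycol i (t + rootWeight (D.d i) w) + z - Acol D i w
        = Ycol i t + (z + (Ycol i (rootWeight (D.d i) w) - Acol D i w)) := by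
      rw [Ycol_add]; abel
    rwa [e]
  | zero => rw [map_zero]; exact zero_mem _
  | add x y _ _ hx hy => rw [map_add]; exact add_mem hx hy
  | smul a x _ hx => rw [map_smul]; exact (Ki D i).smul_mem hx a

theorem isFit_realize {i : I} {s : Multiset ℤ} {z : Mon I} (hz : IsFree i z) :
    IsFit D i (Ycol i s + z) (realize D i (Ycol i s + z) (fitCoef (D.d i) s)) := by
  obtain ⟨h1, h2, h3, h4⟩ := fitCoef_spec (D.d i) s
  refine ⟨realize_mem_Ki D hz h1, ?_, ?_⟩
  · have := realize_apply D i (Ycol i s + z) (fitCoef (D.d i) s) 0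
    rwa [Acol_zero, sub_zero, h2] at this
  · intro m hm
    obtain ⟨v, rfl, hv⟩ := exists_of_realize_ne_zero D hm
    refine ⟨⟨v, rfl⟩, ?_, fun hd => ?_⟩
    · rw [realize_apply]; exact h3 v
    · rw [h4 v hv ((isDomAt_sub_Acol D hz v).mp hd), Acol_zero, sub_zero]

theorem IsFit.unique {i : I} {m : Mon I} {x y : QTorus D} (hx : IsFit D i m x)
    (hy : IsFit D i m y) : x = y := by
  rw [← sub_eq_zero]
  refine eq_zero_of_no_isDomAt D (sub_mem hx.1 hy.1) fun n hn hd => hn ?_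
  rw [QTorus.sub_apply]
  by_cases hnm : n = m
  · rw [hnm, hx.2.1, hy.2.1, sub_self]
  · have h1 : x n = 0 := by
      by_contra h0; exact hnm ((hx.2.2 n h0).2.2 hd)
    have h2 : y n = 0 := by
      by_contra h0; exact hnm ((hy.2.2 n h0).2.2 hd)
    rw [h1, h2, sub_self]

theorem isFit_Fit {i : I} {m : Mon I} (hm : IsDomAt i m) : IsFit D i m (Fit D i m) := by
  obtain ⟨s, z, hz, rfl⟩ := exists_Ycol_of_isDomAt hm
  have h : ∃ x, IsFit D i (Ycol i s + z) x := ⟨_, isFit_realize D hz⟩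
  rw [Fit, dif_pos h]
  exact h.choose_spec

/-- The coefficients of `F_{i,t}(m)` only depend on `d_i` and on the `Y_{i,p}` occurring in `m`. -/
theorem Fit_eq_realize {i : I} {s : Multiset ℤ} {z : Mon I} (hz : IsFree i z) :
    Fit D i (Ycol i s + z) = realize D i (Ycol i s + z) (fitCoef (D.d i) s) :=
  (isFit_Fit D (isDomAt_Ycol_add hz)).unique D (isFit_realize D hz)

theorem Fit_apply_self {i : I} {m : Mon I} (hm : IsDomAt i m) : Fit D i m m = 1 :=
  (isFit_Fit D hm).2.1

theorem Fit_mem_Ki {i : I} {m : Mon I} (hm : IsDomAt i m) : Fit D i m ∈ Ki D i :=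
  (isFit_Fit D hm).1

theorem exists_of_Fit_ne_zero {i : I} {m n : Mon I} (hm : IsDomAt i m) (h : Fit D i m n ≠ 0) :
    ∃ v, n = m - Acol D i v :=
  ((isFit_Fit D hm).2.2 n h).1

theorem Fit_apply_of_isDomAt {i : I} {m n : Mon I} (hm : IsDomAt i m) (hn : IsDomAt i n)
    (hne : n ≠ m) : Fit D i m n = 0 := by
  by_contra h
  exact hne (((isFit_Fit D hm).2.2 n h).2.2 hn)

open Classical in
/-- The elements `F_{i,t}(u)` span `K_{i,t}`, and the coordinates are the coefficients of the
`i`-dominant monomials `u`. -/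
theorem eq_sum_Fit {i : I} {x : QTorus D} (hx : x ∈ Ki D i) :
    x = ∑ u ∈ x.support with IsDomAt i u, x u • Fit D i u := by
  rw [← sub_eq_zero]
  refine eq_zero_of_no_isDomAt D (sub_mem hx (sum_mem fun u hu =>
    (Ki D i).smul_mem (Fit_mem_Ki D (Finset.mem_filter.mp hu).2) _)) fun n hn hd => hn ?_
  rw [QTorus.sub_apply, QTorus.sum_apply, sub_eq_zero]
  have h0 : ∀ u ∈ x.support.filter (IsDomAt i), u ≠ n → (x u • Fit D i u) n = 0 := by
    intro u hu hun
    rw [QTorus.smul_apply, Fit_apply_of_isDomAt D (Finset.mem_filter.mp hu).2 hd (Ne.symm hun),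
      mul_zero]
  by_cases hxn : x n = 0
  · rw [hxn, Finset.sum_eq_zero]
    intro u hu
    refine h0 u hu ?_
    rintro rfl
    exact QTorus.mem_support.mp (Finset.mem_filter.mp hu).1 hxn
  · rw [Finset.sum_eq_single n h0, QTorus.smul_apply, Fit_apply_self D hd, mul_one]
    intro h
    exact absurd (Finset.mem_filter.mpr ⟨QTorus.mem_support.mpr hxn, hd⟩) h

end Fit

/-! ### The algorithm -/

section Algorithm

variable {I : Type*} [Fintype I] [DecidableEq I] (D : CartanDatum I)

theorem algo_zero (m : Mon I) : algo D m 0 = (1, 0) := by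
  rw [algo, if_pos rfl]

open Classical in
theorem algo_snd (m : Mon I) {v : RootExp I} (hv : v ≠ 0) (i : I) :
    (algo D m v).2 i = ∑ w ∈ Finset.Iio v, if IsDomAt i (m - Aprod D w) then
      ((algo D m w).1 - (algo D m w).2 i) * Fit D i (m - Aprod D w) (m - Aprod D v) else 0 := by
  rw [algo, if_neg hv]
  exact Finset.sum_attach (Finset.Iio v) fun w => if IsDomAt i (m - Aprod D w) then
      ((algo D m w).1 - (algo D m w).2 i) * Fit D i (m - Aprod D w) (m - Aprod D v) else 0

open Classical in
theorem algo_fst (m : Mon I) {v : RootExp I} (hv : v ≠ 0) :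
    (algo D m v).1 = if h : ∃ c : Coef, (∃ i, ¬ IsDomAt i (m - Aprod D v)) ∧
        ∀ i, ¬ IsDomAt i (m - Aprod D v) → (algo D m v).2 i = c then h.choose else 0 := by
  rw [algo, if_neg hv]

theorem algo_fst_of_isDom (m : Mon I) {v : RootExp I} (hv : v ≠ 0) (h : IsDom (m - Aprod D v)) :
    (algo D m v).1 = 0 := by
  rw [algo_fst D m hv, dif_neg]
  rintro ⟨c, ⟨i, hi⟩, -⟩
  exact hi (h i)

theorem algo_fst_of_common (m : Mon I) {v : RootExp I} (hv : v ≠ 0) {c : Coef}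
    (h : ¬ IsDom (m - Aprod D v))
    (hc : ∀ i, ¬ IsDomAt i (m - Aprod D v) → (algo D m v).2 i = c) : (algo D m v).1 = c := by
  obtain ⟨i, hi⟩ := not_forall.mp h
  have hex : ∃ c : Coef, (∃ i, ¬ IsDomAt i (m - Aprod D v)) ∧
      ∀ i, ¬ IsDomAt i (m - Aprod D v) → (algo D m v).2 i = c := ⟨c, ⟨i, hi⟩, hc⟩
  rw [algo_fst D m hv, dif_pos hex, ← hex.choose_spec.2 i hi, hc i hi]

theorem algo_snd_of_isDomAt (m : Mon I) (v : RootExp I) {i : I} (hi : IsDomAt i (m - Aprod D v)) :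
    (algo D m v).2 i = 0 := by
  classical
  by_cases hv : v = 0
  · rw [hv, algo_zero]; rfl
  rw [algo_snd D m hv]
  refine Finset.sum_eq_zero fun w hw => ?_
  split_ifs with h
  · rw [Fit_apply_of_isDomAt D h hi, mul_zero]
    intro he
    exact (Finset.mem_Iio.mp hw).ne (sub_Aprod_injective D m he.symm)
  · rfl

/-- An element of `K_t` with the only dominant monomial `m` is computed by the algorithm: at the
monomials that are not `i`-dominant its coefficients are those of its expansion in the `F_{i,t}`. -/
theorem algo_fst_eq_of_isFt {m : Mon I} {x : QTorus D} (hx : IsFt D m x) (v : RootExp I) :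
    (algo D m v).1 = x (m - Aprod D v) := by
  classical
  obtain ⟨hK, hm, hs⟩ := hx
  induction v using WellFoundedLT.induction with
  | _ v ih =>
    by_cases hv : v = 0
    · rw [hv, algo_zero, Aprod_zero, sub_zero, hm]
    have hne : m - Aprod D v ≠ m := by
      intro h
      refine hv (sub_Aprod_injective D m (?_ : m - Aprod D v = m - Aprod D 0))
      rw [h, Aprod_zero, sub_zero]
    by_cases hd : IsDom (m - Aprod D v)
    · rw [algo_fst_of_isDom D m hv hd]
      by_contra h0
      exact (hs _ hne (Ne.symm h0)).2.1 hd
    refine algo_fst_of_common D m hv hd fun i hi => ?_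
    have hKi : x ∈ Ki D i := (Algebra.mem_iInf.mp hK) i
    have hexp : x (m - Aprod D v)
        = ∑ u ∈ x.support with IsDomAt i u, x u * Fit D i u (m - Aprod D v) := by
      conv_lhs => rw [eq_sum_Fit D hKi]
      rw [QTorus.sum_apply]
      rfl
    rw [hexp, algo_snd D m hv]
    refine Finset.sum_bij_ne_zero (fun w _ _ => m - Aprod D w) ?_ ?_ ?_ ?_
    · intro w hw h0
      have hw' := Finset.mem_Iio.mp hw
      split_ifs at h0 with hdom
      · rw [algo_snd_of_isDomAt D m w hdom, sub_zero, ih w hw'] at h0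
        exact Finset.mem_filter.mpr ⟨QTorus.mem_support.mpr (left_ne_zero_of_mul h0), hdom⟩
      · exact absurd rfl h0
    · intro w _ _ w' _ _ h
      exact sub_Aprod_injective D m h
    · intro u hu h0
      obtain ⟨hu, hdom⟩ := Finset.mem_filter.mp hu
      have hxu := QTorus.mem_support.mp hu
      have hle : NakLE D u m := by
        by_cases hum : u = m
        · exact ⟨0, by rw [hum, Aprod_zero, sub_zero]⟩
        · exact (hs u hum hxu).1
      obtain ⟨w, rfl⟩ := hle
      obtain ⟨t, ht⟩ := exists_of_Fit_ne_zero D hdom (right_ne_zero_of_mul h0)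
      have hvw : v = w + col i t := by
        apply sub_Aprod_injective D m
        dsimp only
        rw [ht, Aprod_add, Aprod_col, sub_sub]
      have hlt : w < v := by
        refine lt_of_le_of_ne (hvw ▸ le_self_add) ?_
        rintro rfl
        exact hi hdom
      refine ⟨w, Finset.mem_Iio.mpr hlt, ?_, rfl⟩
      rwa [if_pos hdom, algo_snd_of_isDomAt D m w hdom, sub_zero, ih w hlt]
    · intro w hw h0
      have hw' := Finset.mem_Iio.mp hw
      split_ifs at h0 ⊢ with hdom
      · rw [algo_snd_of_isDomAt D m w hdom, sub_zero, ih w hw']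
      · exact absurd rfl h0

theorem Ft_apply (m : Mon I) (v : RootExp I) : Ft D m (m - Aprod D v) = (algo D m v).1 := by
  have h : ∃ w : RootExp I, m - Aprod D v = m - Aprod D w := ⟨v, rfl⟩
  rw [Ft, dif_pos h, ← sub_Aprod_injective D m h.choose_spec]

theorem Ft_of_not_nakLE {m n : Mon I} (h : ¬ NakLE D n m) : Ft D m n = 0 := dif_neg h

theorem nakLE_refl (m : Mon I) : NakLE D m m := ⟨0, by rw [Aprod_zero, sub_zero]⟩

theorem isPointed_Ft (m : Mon I) : IsPointed D m (Ft D m) := by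
  refine ⟨?_, fun n hn => ?_⟩
  · have := Ft_apply D m 0
    rwa [Aprod_zero, sub_zero, algo_zero] at this
  · by_contra h
    exact hn (Ft_of_not_nakLE D h)

theorem coe_eq_Ft_of_isFt {m : Mon I} {x : QTorus D} (hx : IsFt D m x) : ⇑x = Ft D m := by
  funext n
  by_cases h : NakLE D n m
  · obtain ⟨v, rfl⟩ := h
    rw [Ft_apply, algo_fst_eq_of_isFt D hx]
  · rw [Ft_of_not_nakLE D h]
    by_contra h0
    by_cases hn : n = m
    · exact h (hn ▸ nakLE_refl D m)
    · exact h (hx.2.2 n hn h0).1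

theorem Ft_zero : Ft D 0 = fone I := by
  have h : IsFt D 0 (1 : QTorus D) := by
    refine ⟨one_mem _, Finsupp.single_eq_same, fun n hn h0 => absurd ?_ h0⟩
    exact Finsupp.single_eq_of_ne hn
  rw [← coe_eq_Ft_of_isFt D h]
  rfl

theorem IsPointed.unique {m n : Mon I} {y : FormalSum I} (hm : IsPointed D m y)
    (hn : IsPointed D n y) : m = n := by
  obtain ⟨v, hv⟩ := hn.2 m (by rw [hm.1]; exact one_ne_zero)
  obtain ⟨w, hw⟩ := hm.2 n (by rw [hn.1]; exact one_ne_zero)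
  have h : v + w = 0 := by
    apply Aprod_injective D
    have : Aprod D v + Aprod D w = 0 := by
      rw [hv] at hw
      have h1 : n = n - (Aprod D v + Aprod D w) := by rw [← sub_sub]; exact hw
      exact (sub_eq_self.mp h1.symm)
    rw [Aprod_add, this, Aprod_zero]
  rw [hv, (add_eq_zero.mp h).1, Aprod_zero, sub_zero]

end Algorithm

/-! ### Restriction to a subset of the Dynkin nodes -/

section Restriction

variable {I J : Type*} (ι : I ↪ J)

/-- Families of multiplicities over a subset of the nodes, extended by zero. -/
noncomputable def incl (v : RootExp I) : RootExp J := v.mapDomain (Prod.map ι id)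

theorem prodMap_injective : Function.Injective (Prod.map ι id : I × ℤ → J × ℤ) :=
  ι.injective.prodMap Function.injective_id

theorem incl_apply (v : RootExp I) (i : I) (p : ℤ) : incl ι v (ι i, p) = v (i, p) :=
  Finsupp.mapDomain_apply (prodMap_injective ι) v (i, p)

theorem incl_apply_of_notMem (v : RootExp I) {j : J} (hj : j ∉ Set.range ι) (p : ℤ) :
    incl ι v (j, p) = 0 := by
  refine Finsupp.mapDomain_of_notMem_range _ _ ?_
  rintro ⟨⟨i, q⟩, h⟩
  exact hj ⟨i, congrArg Prod.fst h⟩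

theorem incl_injective : Function.Injective (incl ι) :=
  Finsupp.mapDomain_injective (prodMap_injective ι)

theorem incl_zero : incl ι (0 : RootExp I) = 0 := Finsupp.mapDomain_zero

theorem incl_add (v w : RootExp I) : incl ι (v + w) = incl ι v + incl ι w :=
  Finsupp.mapDomain_add

theorem incl_le_incl {v w : RootExp I} : incl ι v ≤ incl ι w ↔ v ≤ w := by
  constructor
  · rintro h ⟨i, p⟩
    have := h (ι i, p)
    rwa [incl_apply, incl_apply] at this
  · intro h
    obtain ⟨u, rfl⟩ := exists_add_of_le h
    rw [incl_add]
    exact le_self_add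

theorem exists_incl_of_le {w : RootExp J} {v : RootExp I} (h : w ≤ incl ι v) :
    ∃ u, incl ι u = w := by
  refine ⟨w.comapDomain (Prod.map ι id) (prodMap_injective ι).injOn,
    Finsupp.mapDomain_comapDomain _ (prodMap_injective ι) w ?_⟩
  rintro ⟨j, p⟩ hx
  by_cases hj : j ∈ Set.range ι
  · obtain ⟨i, rfl⟩ := hj
    exact ⟨(i, p), rfl⟩
  · have h1 := h (j, p)
    rw [incl_apply_of_notMem ι v hj] at h1
    exact absurd (Nat.le_zero.mp h1) (Finsupp.mem_support_iff.mp hx)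

theorem incl_col (i : I) (t : ℤ →₀ ℕ) : incl ι (col i t) = col (ι i) t := by
  rw [incl, col, col, ← Finsupp.mapDomain_comp]
  rfl

open Classical in
theorem Iio_incl [DecidableEq I] [DecidableEq J] (v : RootExp I) : Finset.Iio (incl ι v) = (Finset.Iio v).image (incl ι) := by
  ext w
  rw [Finset.mem_Iio, Finset.mem_image]
  constructor
  · intro h
    obtain ⟨u, rfl⟩ := exists_incl_of_le ι h.le
    refine ⟨u, Finset.mem_Iio.mpr (lt_of_le_of_ne ((incl_le_incl ι).mp h.le) ?_), rfl⟩
    rintro rfl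
    exact lt_irrefl _ h
  · rintro ⟨u, hu, rfl⟩
    have hu := Finset.mem_Iio.mp hu
    exact lt_of_le_of_ne ((incl_le_incl ι).mpr hu.le) fun h => hu.ne (incl_injective ι h)

open Classical in
theorem Iic_incl [DecidableEq I] [DecidableEq J] (v : RootExp I) : Finset.Iic (incl ι v) = (Finset.Iic v).image (incl ι) := by
  ext w
  rw [Finset.mem_Iic, Finset.mem_image]
  constructor
  · intro h
    obtain ⟨u, rfl⟩ := exists_incl_of_le ι h
    exact ⟨u, Finset.mem_Iic.mpr ((incl_le_incl ι).mp h), rfl⟩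
  · rintro ⟨u, hu, rfl⟩
    exact (incl_le_incl ι).mpr (Finset.mem_Iic.mp hu)

theorem res_apply (m : Mon J) (i : I) (p : ℤ) : res ι m (i, p) = m (ι i, p) := rfl

theorem res_zero : res ι (0 : Mon J) = 0 := by ext ⟨i, p⟩; rfl

theorem res_add (m n : Mon J) : res ι (m + n) = res ι m + res ι n := by ext ⟨i, p⟩; rfl

theorem res_sub (m n : Mon J) : res ι (m - n) = res ι m - res ι n := by ext ⟨i, p⟩; rfl

theorem isDomAt_res {m : Mon J} {i : I} : IsDomAt i (res ι m) ↔ IsDomAt (ι i) m := Iff.rfl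

theorem res_Y (i : I) (p : ℤ) : res ι (Y (ι i, p)) = Y (i, p) := by
  classical
  ext ⟨j, s⟩
  simp [res_apply, Y, Finsupp.single_apply]

theorem res_Y_of_notMem {j : J} (hj : j ∉ Set.range ι) (p : ℤ) : res ι (Y (j, p)) = 0 := by
  ext ⟨i, s⟩
  have : j ≠ ι i := by rintro rfl; exact hj ⟨i, rfl⟩
  simp [res_apply, Y, this]

theorem res_Ycol (i : I) (s : Multiset ℤ) : res ι (Ycol (ι i) s) = Ycol i s := by
  induction s using Multiset.induction_on with
  | empty => exact res_zero ι
  | cons p s ih => rw [Ycol_cons, Ycol_cons, res_add, ih, res_Y]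

variable [Fintype I] [DecidableEq I] [Fintype J] [DecidableEq J]
  {D : CartanDatum I} {D' : CartanDatum J} {ι}

omit [Fintype I] [DecidableEq I] in
theorem Aprod_incl (v : RootExp I) :
    Aprod D' (incl ι v) = v.sum fun x n => n • A D' (ι x.1, x.2) :=
  Finsupp.sum_mapDomain_index (fun _ => zero_smul _ _) fun _ _ _ => add_smul _ _ _

omit [Fintype I] [DecidableEq I] in
theorem nakLEOn_iff {m n : Mon J} : NakLEOn D' ι n m ↔ ∃ v : RootExp I, n = m - Aprod D' (incl ι v) := by
  simp only [NakLEOn, Aprod_incl]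

omit [Fintype I] [DecidableEq I] in
theorem sub_Aprod_incl_injective (m : Mon J) :
    Function.Injective fun v : RootExp I => m - Aprod D' (incl ι v) :=
  (sub_Aprod_injective D' m).comp (incl_injective ι)

theorem A_apply_of_ne_eq {j i : J} (hji : j ≠ i) (p s : ℤ) : A D' (i, p) (j, s)
    = -∑ k ∈ Finset.range (D'.C j i).natAbs,
        if p + ((D'.C j i).natAbs - 1 - 2 * (k : ℤ)) = s then (1 : ℤ) else 0 := by
  unfold A
  rw [Finsupp.sub_apply, Finsupp.finsetSum_apply, Finset.sum_eq_single j]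
  · rw [Finsupp.finsetSum_apply]
    simp [Y, Finsupp.single_apply, hji.symm]
  · intro k _ hk
    rw [Finsupp.finsetSum_apply]
    refine Finset.sum_eq_zero fun r _ => ?_
    simp [Y, hk]
  · intro h
    exact absurd (Finset.mem_erase.mpr ⟨hji, Finset.mem_univ j⟩) h

theorem res_A (hι : IsInclusion D D' ι) (i : I) (p : ℤ) : res ι (A D' (ι i, p)) = A D (i, p) := by
  ext ⟨j, s⟩
  rw [res_apply]
  by_cases h : j = i
  · subst h
    rw [A_apply_same, A_apply_same, hι.2]
    simp [Y, Finsupp.single_apply]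
  · rw [A_apply_of_ne_eq (fun h' => h (ι.injective h')), A_apply_of_ne_eq h, hι.1]

theorem res_Aprod (hι : IsInclusion D D' ι) (v : RootExp I) :
    res ι (Aprod D' (incl ι v)) = Aprod D v := by
  induction v using Finsupp.induction_linear with
  | zero => rw [incl_zero, Aprod_zero, Aprod_zero, res_zero]
  | add f g hf hg => rw [incl_add, Aprod_add, Aprod_add, res_add, hf, hg]
  | single x n =>
    have h1 : incl ι (Finsupp.single x n) = Finsupp.single (ι x.1, x.2) n :=
      Finsupp.mapDomain_single
    rw [h1, Aprod_single, Aprod_single, ← res_A hι x.1 x.2]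
    ext ⟨j, s⟩
    rfl

theorem res_sub_Aprod (hι : IsInclusion D D' ι) (m : Mon J) (v : RootExp I) :
    res ι (m - Aprod D' (incl ι v)) = res ι m - Aprod D v := by
  rw [res_sub, res_Aprod hι]

/-- The forms `γ` of the two Lie algebras differ, but their values on the `A_{i,p}` agree. -/
theorem gamma_Aprod_incl (hι : IsInclusion D D' ι) (m : Mon J) (v : RootExp I) :
    gamma D' m (Aprod D' (incl ι v)) = gamma D (res ι m) (Aprod D v) := by
  induction v using Finsupp.induction_linear with
  | zero => rw [incl_zero, Aprod_zero, Aprod_zero, gamma_zero_right, gamma_zero_right]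
  | add f g hf hg =>
    rw [incl_add, Aprod_add, Aprod_add, gamma_add_right, gamma_add_right, hf, hg]
  | single x n =>
    have h1 : incl ι (Finsupp.single x n) = Finsupp.single (ι x.1, x.2) n :=
      Finsupp.mapDomain_single
    obtain ⟨i, p⟩ := x
    rw [h1, Aprod_single, Aprod_single, ← gammaHom_apply, ← gammaHom_apply, map_nsmul, map_nsmul,
      gammaHom_apply, gammaHom_apply, gamma_A_right, gamma_A_right, hι.2, res_apply, res_apply]

omit [Fintype I] [DecidableEq I] in
/-- Dividing by monomials in the `A_{i,p}` with `i ∈ I` preserves dominance outside of `I`. -/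
theorem isDomAt_sub_Aprod_incl {m : Mon J} {j : J} (hj : j ∉ Set.range ι) (hm : IsDomAt j m)
    (v : RootExp I) : IsDomAt j (m - Aprod D' (incl ι v)) := by
  have h : ∀ p, Aprod D' (incl ι v) (j, p) ≤ 0 := by
    intro p
    induction v using Finsupp.induction_linear with
    | zero => rw [incl_zero, Aprod_zero]; exact le_rfl
    | add f g hf hg => rw [incl_add, Aprod_add, Finsupp.add_apply]; exact add_nonpos hf hg
    | single x n =>
      have h1 : incl ι (Finsupp.single x n) = Finsupp.single (ι x.1, x.2) n :=
        Finsupp.mapDomain_single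
      rw [h1, Aprod_single, Finsupp.smul_apply]
      exact nsmul_nonpos (A_apply_of_ne D' (by rintro rfl; exact hj ⟨_, rfl⟩) _ _) n
  intro p
  rw [Finsupp.sub_apply]
  linarith [hm p, h p]

theorem isDom_iff_res (hι : IsInclusion D D' ι) {m : Mon J}
    (hm : ∀ j ∉ Set.range ι, IsDomAt j m) (v : RootExp I) :
    IsDom (m - Aprod D' (incl ι v)) ↔ IsDom (res ι m - Aprod D v) := by
  rw [← res_sub_Aprod hι]
  refine ⟨fun h i => h (ι i), fun h j => ?_⟩
  by_cases hj : j ∈ Set.range ι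
  · obtain ⟨i, rfl⟩ := hj
    exact h i
  · exact isDomAt_sub_Aprod_incl hj (hm j hj) v

theorem Fit_res (hι : IsInclusion D D' ι) (m : Mon J) (i : I) (w v : RootExp I)
    (hd : IsDomAt (ι i) (m - Aprod D' (incl ι w))) :
    Fit D' (ι i) (m - Aprod D' (incl ι w)) (m - Aprod D' (incl ι v))
      = Fit D i (res ι m - Aprod D w) (res ι m - Aprod D v) := by
  obtain ⟨s, z, hz, h⟩ := exists_Ycol_of_isDomAt hd
  have h' : res ι m - Aprod D w = Ycol i s + res ι z := by
    rw [← res_sub_Aprod hι, h, res_add, res_Ycol]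
  have hz' : IsFree i (res ι z) := hz
  by_cases hex : ∃ t, v = w + col i t
  · obtain ⟨t, rfl⟩ := hex
    rw [incl_add, incl_col, Aprod_add, Aprod_add, Aprod_col, Aprod_col, ← sub_sub, ← sub_sub, h, h',
      Fit_eq_realize D' hz, Fit_eq_realize D hz', realize_apply, realize_apply, hι.2]
  · have h1 : Fit D' (ι i) (m - Aprod D' (incl ι w)) (m - Aprod D' (incl ι v)) = 0 := by
      by_contra h0
      obtain ⟨t, ht⟩ := exists_of_Fit_ne_zero D' hd h0
      refine hex ⟨t, sub_Aprod_incl_injective (D' := D') (ι := ι) m ?_⟩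
      dsimp only
      rw [ht, incl_add, incl_col, Aprod_add, Aprod_col, sub_sub]
    have h2 : Fit D i (res ι m - Aprod D w) (res ι m - Aprod D v) = 0 := by
      by_contra h0
      have hd' : IsDomAt i (res ι m - Aprod D w) := by rw [← res_sub_Aprod hι]; exact hd
      obtain ⟨t, ht⟩ := exists_of_Fit_ne_zero D hd' h0
      refine hex ⟨t, sub_Aprod_injective D (res ι m) ?_⟩
      dsimp only
      rw [ht, Aprod_add, Aprod_col, sub_sub]
    rw [h1, h2]

open Classical in
theorem dite_choose_congr {p q : Coef → Prop} (h : ∀ c, p c ↔ q c) :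
    (if h : ∃ c, p c then h.choose else 0) = if h : ∃ c, q c then h.choose else 0 := by
  obtain rfl : p = q := funext fun c => propext (h c)
  rfl

/-- Along the monomials `m ∏ A_{i,p}^{-v(i,p)}` with `i ∈ I` the algorithm for the large Lie algebra
runs as the one for the small Lie algebra, as these monomials stay dominant outside of `I`. -/
theorem algo_incl (hι : IsInclusion D D' ι) {m : Mon J} (hm : ∀ j ∉ Set.range ι, IsDomAt j m)
    (v : RootExp I) : (algo D' m (incl ι v)).1 = (algo D (res ι m) v).1 ∧
      ∀ i, (algo D' m (incl ι v)).2 (ι i) = (algo D (res ι m) v).2 i := by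
  classical
  induction v using WellFoundedLT.induction with
  | _ v ih =>
    by_cases hv : v = 0
    · rw [hv, incl_zero, algo_zero, algo_zero]
      exact ⟨rfl, fun _ => rfl⟩
    have hv' : incl ι v ≠ 0 := fun h => hv (incl_injective ι (by rw [h, incl_zero]))
    have hdom : ∀ i w, IsDomAt (ι i) (m - Aprod D' (incl ι w))
        ↔ IsDomAt i (res ι m - Aprod D w) := by
      intro i w
      rw [← res_sub_Aprod hι, isDomAt_res]
    have h2 : ∀ i, (algo D' m (incl ι v)).2 (ι i) = (algo D (res ι m) v).2 i := by
      intro i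
      rw [algo_snd D' m hv', algo_snd D _ hv, Iio_incl, Finset.sum_image (incl_injective ι).injOn]
      refine Finset.sum_congr rfl fun w hw => ?_
      obtain ⟨ih1, ih2⟩ := ih w (Finset.mem_Iio.mp hw)
      by_cases hd : IsDomAt (ι i) (m - Aprod D' (incl ι w))
      · rw [if_pos hd, if_pos ((hdom i w).mp hd), ih1, ih2, Fit_res hι m i w v hd]
      · rw [if_neg hd, if_neg fun h => hd ((hdom i w).mpr h)]
    refine ⟨?_, h2⟩
    rw [algo_fst D' m hv', algo_fst D _ hv]
    refine dite_choose_congr fun c => and_congr ?_ ?_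
    · constructor
      · rintro ⟨j, hj⟩
        by_cases hr : j ∈ Set.range ι
        · obtain ⟨i, rfl⟩ := hr
          exact ⟨i, fun h => hj ((hdom i v).mpr h)⟩
        · exact absurd (isDomAt_sub_Aprod_incl hr (hm j hr) v) hj
      · rintro ⟨i, hi⟩
        exact ⟨ι i, fun h => hi ((hdom i v).mp h)⟩
    · constructor
      · intro h i hi
        rw [← h2]
        exact h (ι i) fun hd => hi ((hdom i v).mp hd)
      · intro h j hj
        by_cases hr : j ∈ Set.range ι
        · obtain ⟨i, rfl⟩ := hr
          rw [h2]
          exact h i fun hd => hj ((hdom i v).mpr hd)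
        · exact absurd (isDomAt_sub_Aprod_incl hr (hm j hr) v) hj

theorem Ft_incl (hι : IsInclusion D D' ι) {m : Mon J} (hm : ∀ j ∉ Set.range ι, IsDomAt j m)
    (v : RootExp I) :
    Ft D' m (m - Aprod D' (incl ι v)) = Ft D (res ι m) (res ι m - Aprod D v) := by
  rw [Ft_apply, Ft_apply, (algo_incl hι hm v).1]

/-! ### The freezing operator -/

theorem freezeAt_apply (hι : IsInclusion D D' ι) (m : Mon J) (y : FormalSum J) (v : RootExp I) :
    freezeAt D' ι m y (res ι m - Aprod D v) = y (m - Aprod D' (incl ι v)) := by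
  have h : {m' : Mon J | NakLEOn D' ι m' m ∧ res ι m' = res ι m - Aprod D v}
      = {m - Aprod D' (incl ι v)} := by
    ext m'
    simp only [Set.mem_ofPred_eq, Set.mem_singleton_iff, nakLEOn_iff]
    constructor
    · rintro ⟨⟨w, rfl⟩, hw⟩
      rw [res_sub_Aprod hι] at hw
      rw [sub_Aprod_injective D (res ι m) hw]
    · rintro rfl
      exact ⟨⟨v, rfl⟩, res_sub_Aprod hι m v⟩
  rw [freezeAt, h, finsum_mem_singleton]

theorem freezeAt_of_not_nakLE (hι : IsInclusion D D' ι) (m : Mon J) (y : FormalSum J) {n : Mon I}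
    (hn : ¬ NakLE D n (res ι m)) : freezeAt D' ι m y n = 0 := by
  have h : {m' : Mon J | NakLEOn D' ι m' m ∧ res ι m' = n} = ∅ := by
    rw [Set.eq_empty_iff_forall_notMem]
    rintro m' ⟨h1, rfl⟩
    obtain ⟨v, rfl⟩ := nakLEOn_iff.mp h1
    exact hn ⟨v, res_sub_Aprod hι m v⟩
  rw [freezeAt, h, finsum_mem_empty]

omit [Fintype I] [DecidableEq I] in
theorem freeze_eq_freezeAt {m : Mon J} {y : FormalSum J} (h : IsPointed D' m y) :
    freeze D' ι y = freezeAt D' ι m y := by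
  have hex : ∃ m, IsPointed D' m y := ⟨m, h⟩
  rw [freeze, dif_pos hex, IsPointed.unique D' hex.choose_spec h]

/-- The freezing of a pointed sum is determined by its coefficients at the `m ∏ A_{i,p}^{-v(i,p)}`
with `i ∈ I`. -/
theorem freeze_eq (hι : IsInclusion D D' ι) {m : Mon J} {y : FormalSum J} (h : IsPointed D' m y)
    {z : FormalSum I} (hz : ∀ n, z n ≠ 0 → NakLE D n (res ι m))
    (hc : ∀ v : RootExp I, y (m - Aprod D' (incl ι v)) = z (res ι m - Aprod D v)) :
    freeze D' ι y = z := by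
  rw [freeze_eq_freezeAt h]
  funext n
  by_cases hn : NakLE D n (res ι m)
  · obtain ⟨v, rfl⟩ := hn
    rw [freezeAt_apply hι, hc]
  · rw [freezeAt_of_not_nakLE hι m y hn]
    by_contra h0
    exact hn (hz n (Ne.symm h0))

theorem freeze_Ft (hι : IsInclusion D D' ι) {m : Mon J} (hm : IsDom m) :
    freeze D' ι (Ft D' m) = Ft D (res ι m) :=
  freeze_eq hι (isPointed_Ft D' m) (isPointed_Ft D _).2 fun v => Ft_incl hι (fun j _ => hm j) v

/-- The freezing of an element of `K̃_t` with the only dominant monomial `m` lies in `K_{i,t}`: it is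
the sum of the terms of its expansion in the `F̃_{i,t}(u)` with `u ≤_I m`, each of which restricts
to a multiple of `F_{i,t}(res_I(u))`. -/
theorem exists_mem_Ki_eq_freezeAt (hι : IsInclusion D D' ι) {m : Mon J} {x : QTorus D'}
    (hx : IsFt D' m x) (i : I) : ∃ y ∈ Ki D i, ⇑y = freezeAt D' ι m ⇑x := by
  classical
  have hKi : x ∈ Ki D' (ι i) := (Algebra.mem_iInf.mp hx.1) (ι i)
  have hle : ∀ u, x u ≠ 0 → NakLE D' u m := by
    intro u hu
    by_cases hum : u = m
    · exact hum ▸ nakLE_refl D' m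
    · exact (hx.2.2 u hum hu).1
  let S := x.support.filter (IsDomAt (ι i))
  have hS : ∀ u ∈ S, x u ≠ 0 ∧ IsDomAt (ι i) u := fun u hu =>
    ⟨QTorus.mem_support.mp (Finset.mem_filter.mp hu).1, (Finset.mem_filter.mp hu).2⟩
  have hexp : ∀ n, x n = ∑ u ∈ S, x u * Fit D' (ι i) u n := by
    intro n
    conv_lhs => rw [eq_sum_Fit D' hKi]
    rw [QTorus.sum_apply]
    rfl
  refine ⟨∑ u ∈ S with NakLEOn D' ι u m, x u • Fit D i (res ι u), sum_mem fun u hu => ?_, ?_⟩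
  · exact (Ki D i).smul_mem (Fit_mem_Ki D ((isDomAt_res ι).mpr (hS u (Finset.mem_filter.mp hu).1).2)) _
  funext n
  rw [QTorus.sum_apply]
  by_cases hn : NakLE D n (res ι m)
  · obtain ⟨v, rfl⟩ := hn
    rw [freezeAt_apply hι, hexp, Finset.sum_filter]
    refine Finset.sum_congr rfl fun u hu => ?_
    obtain ⟨hu0, hud⟩ := hS u hu
    split_ifs with h
    · obtain ⟨w, rfl⟩ := nakLEOn_iff.mp h
      rw [QTorus.smul_apply, Fit_res hι m i w v hud, res_sub_Aprod hι]
    · symm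
      by_contra h0
      obtain ⟨t, ht⟩ := exists_of_Fit_ne_zero D' hud (right_ne_zero_of_mul h0)
      obtain ⟨w', rfl⟩ := hle u hu0
      have hw : incl ι v = w' + col (ι i) t := by
        apply sub_Aprod_injective D' m
        dsimp only
        rw [ht, Aprod_add, Aprod_col, sub_sub]
      obtain ⟨w, rfl⟩ := exists_incl_of_le ι (hw ▸ le_self_add : w' ≤ incl ι v)
      exact h (nakLEOn_iff.mpr ⟨w, rfl⟩)
  · rw [freezeAt_of_not_nakLE hι m _ hn]
    refine Finset.sum_eq_zero fun u hu => ?_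
    obtain ⟨hu, h⟩ := Finset.mem_filter.mp hu
    obtain ⟨w, rfl⟩ := nakLEOn_iff.mp h
    rw [QTorus.smul_apply]
    by_contra h0
    obtain ⟨t, ht⟩ := exists_of_Fit_ne_zero D ((isDomAt_res ι).mpr (hS _ hu).2)
      (right_ne_zero_of_mul h0)
    refine hn ⟨w + col i t, ?_⟩
    rw [ht, res_sub_Aprod hι, Aprod_add, Aprod_col, sub_sub]

theorem exists_isFt_eq_freeze (hι : IsInclusion D D' ι) {m : Mon J} (hm : IsDom m) {x : QTorus D'}
    (hx : IsFt D' m x) : ∃ y : QTorus D, ⇑y = freeze D' ι ⇑x ∧ IsFt D (res ι m) y := by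
  have hp : IsPointed D' m ⇑x := by
    rw [coe_eq_Ft_of_isFt D' hx]; exact isPointed_Ft D' m
  obtain ⟨i₀, -⟩ := D.d_min
  obtain ⟨y, -, hy⟩ := exists_mem_Ki_eq_freezeAt hι hx i₀
  refine ⟨y, by rw [freeze_eq_freezeAt hp, hy], Algebra.mem_iInf.mpr fun i => ?_, ?_, ?_⟩
  · obtain ⟨y', hy'K, hy'⟩ := exists_mem_Ki_eq_freezeAt hι hx i
    have : y = y' := QTorus.ext fun n => by rw [hy, hy']
    rwa [this]
  · have := freezeAt_apply hι m ⇑x 0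
    rw [Aprod_zero, incl_zero, Aprod_zero, sub_zero, sub_zero, hx.2.1] at this
    rw [hy, this]
  · intro n hn h0
    rw [hy] at h0
    have hle : NakLE D n (res ι m) := by
      by_contra h
      exact h0 (freezeAt_of_not_nakLE hι m _ h)
    obtain ⟨v, rfl⟩ := hle
    rw [freezeAt_apply hι] at h0
    have hne : m - Aprod D' (incl ι v) ≠ m := by
      intro h
      apply hn
      rw [← res_sub_Aprod hι, h]
    obtain ⟨-, h2, h3⟩ := hx.2.2 _ hne h0
    refine ⟨⟨v, rfl⟩, fun hd => h2 ((isDom_iff_res hι (fun j _ => hm j) v).mpr hd), ?_⟩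
    rw [hy, freezeAt_apply hι]
    exact h3

/-! ### Products of pointed sums -/

omit [Fintype I] [DecidableEq I] [Fintype J] [DecidableEq J] in
theorem sum_map_Y_cons (x : I × ℤ) (L : List (I × ℤ)) :
    ((x :: L).map Y).sum = Y x + (L.map Y).sum := by
  rw [List.map_cons, List.sum_cons]

variable (D) in
/-- The coefficients of the normalized product of two pointed sums. Only the values of `γ` on the
`A_{i,p}` occur in it. -/
theorem fmul_apply {m n : Mon I} {f g : FormalSum I} (hf : ∀ k, f k ≠ 0 → NakLE D k m)
    (hg : ∀ k, g k ≠ 0 → NakLE D k n) (v : RootExp I) :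
    LaurentPolynomial.T (-gamma D m n) * fmul D f g (m + n - Aprod D v)
      = ∑ w ∈ Finset.Iic v, LaurentPolynomial.T
          (gamma D n (Aprod D w) - gamma D m (Aprod D (v - w))
            + gamma D (Aprod D w) (Aprod D (v - w)))
          * f (m - Aprod D w) * g (n - Aprod D (v - w)) := by
  classical
  have hsub : ∀ w ≤ v, m + n - Aprod D v - (m - Aprod D w) = n - Aprod D (v - w) := by
    intro w hw
    have : Aprod D v = Aprod D (v - w) + Aprod D w := by rw [← Aprod_add, tsub_add_cancel_of_le hw]
    rw [this]; abel
  have hsupp : (Function.support fun k : Mon I => LaurentPolynomial.T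
      (gamma D k (m + n - Aprod D v - k)) * f k * g (m + n - Aprod D v - k))
      ⊆ ((Finset.Iic v).image fun w => m - Aprod D w : Finset (Mon I)) := by
    intro k hk
    rw [Function.mem_support] at hk
    obtain ⟨w, rfl⟩ := hf k (right_ne_zero_of_mul (left_ne_zero_of_mul hk))
    obtain ⟨u, hu⟩ := hg _ (right_ne_zero_of_mul hk)
    have : v = w + u := by
      apply sub_Aprod_injective D (m + n)
      dsimp only
      rw [Aprod_add]
      have h2 : m + n - Aprod D v = (m + n - Aprod D v - (m - Aprod D w)) + (m - Aprod D w) := by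
        abel
      rw [h2, hu]; abel
    rw [Finset.coe_image]
    exact ⟨w, by rw [Finset.mem_coe, Finset.mem_Iic, this]; exact le_self_add, rfl⟩
  rw [fmul, finsum_eq_sum_of_support_subset _ hsupp,
    Finset.sum_image (sub_Aprod_injective D m).injOn, Finset.mul_sum]
  refine Finset.sum_congr rfl fun w hw => ?_
  rw [hsub w (Finset.mem_Iic.mp hw), ← mul_assoc, ← mul_assoc, ← LaurentPolynomial.T_add]
  congr 3
  rw [gamma_sub_left, gamma_sub_right, gamma_sub_right, gamma_Aprod_eq_neg D w n]
  ring

variable (D) in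
theorem isPointed_fmul {m n : Mon I} {f g : FormalSum I} (hf : IsPointed D m f)
    (hg : IsPointed D n g) :
    IsPointed D (m + n) ((LaurentPolynomial.T (-gamma D m n) : Coef) • fmul D f g) := by
  constructor
  · have h := fmul_apply D hf.2 hg.2 0
    rw [Aprod_zero, sub_zero] at h
    rw [Pi.smul_apply, smul_eq_mul, h]
    have h0 : Finset.Iic (0 : RootExp I) = {0} := by
      ext w; simp
    rw [h0, Finset.sum_singleton, tsub_zero, Aprod_zero, sub_zero, sub_zero, hf.1, hg.1,
      gamma_zero_right, gamma_zero_right, gamma_zero_right]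
    simp
  · intro k hk
    rw [Pi.smul_apply, smul_eq_mul] at hk
    obtain ⟨a, ha⟩ := not_forall.mp fun h0 => right_ne_zero_of_mul hk
      (finsum_eq_zero_of_forall_eq_zero h0)
    obtain ⟨w, rfl⟩ := hf.2 a (right_ne_zero_of_mul (left_ne_zero_of_mul ha))
    obtain ⟨u, hu⟩ := hg.2 _ (right_ne_zero_of_mul ha)
    refine ⟨w + u, ?_⟩
    rw [Aprod_add, eq_add_of_sub_eq hu]; abel

theorem fmul_incl (hι : IsInclusion D D' ι) {m n : Mon J} {f g : FormalSum J} {f₀ g₀ : FormalSum I}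
    (hf : IsPointed D' m f) (hg : IsPointed D' n g) (hf₀ : IsPointed D (res ι m) f₀)
    (hg₀ : IsPointed D (res ι n) g₀)
    (h1 : ∀ v : RootExp I, f (m - Aprod D' (incl ι v)) = f₀ (res ι m - Aprod D v))
    (h2 : ∀ v : RootExp I, g (n - Aprod D' (incl ι v)) = g₀ (res ι n - Aprod D v))
    (v : RootExp I) :
    ((LaurentPolynomial.T (-gamma D' m n) : Coef) • fmul D' f g) (m + n - Aprod D' (incl ι v))
      = ((LaurentPolynomial.T (-gamma D (res ι m) (res ι n)) : Coef) • fmul D f₀ g₀)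
        (res ι (m + n) - Aprod D v) := by
  classical
  rw [Pi.smul_apply, Pi.smul_apply, smul_eq_mul, smul_eq_mul, res_add, fmul_apply D' hf.2 hg.2,
    fmul_apply D hf₀.2 hg₀.2, Iic_incl, Finset.sum_image (incl_injective ι).injOn]
  refine Finset.sum_congr rfl fun w hw => ?_
  have h3 : incl ι v - incl ι w = incl ι (v - w) := by
    rw [tsub_eq_iff_eq_add_of_le ((incl_le_incl ι).mpr (Finset.mem_Iic.mp hw)), ← incl_add,
      tsub_add_cancel_of_le (Finset.mem_Iic.mp hw)]
  rw [h3, h1, h2, gamma_Aprod_incl hι, gamma_Aprod_incl hι, gamma_Aprod_incl hι, res_Aprod hι]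

variable (D) in
theorem fone_fmul (g : FormalSum I) : fmul D (fone I) g = g := by
  funext n
  rw [fmul, finsum_eq_single _ 0]
  · rw [gamma_zero_left, LaurentPolynomial.T_zero, sub_zero, fone, Finsupp.single_eq_same, one_mul,
      one_mul]
  · intro k hk
    rw [fone, Finsupp.single_eq_of_ne hk, mul_zero, zero_mul]

/-! ### The standard basis -/

variable (D) in
theorem fmul_smul (k : ℤ) (f g : FormalSum I) : fmul D f ((LaurentPolynomial.T k : Coef) • g)
    = (LaurentPolynomial.T k : Coef) • fmul D f g := by
  funext n
  rw [Pi.smul_apply, fmul, fmul, smul_finsum]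
  refine finsum_congr fun a => ?_
  rw [Pi.smul_apply, smul_eq_mul, smul_eq_mul, mul_left_comm]

variable (D) in
theorem Et_nil : Et D [] = fone I := by
  rw [Et, gammaList, neg_zero, LaurentPolynomial.T_zero, one_smul]
  rfl

variable (D) in
theorem Et_cons (x : I × ℤ) (L : List (I × ℤ)) : Et D (x :: L)
    = (LaurentPolynomial.T (-gamma D (Y x) (L.map Y).sum) : Coef) •
      fmul D (Ft D (Y x)) (Et D L) := by
  have h : (L.map fun y => gamma D (Y x) (Y y)).sum = gamma D (Y x) (L.map Y).sum := by
    rw [← gammaHom_apply, map_list_sum, List.map_map]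
    rfl
  rw [Et, Et, gammaList, h, fmul_smul, smul_smul, ← LaurentPolynomial.T_add, neg_add]
  rfl

variable (D) in
theorem isPointed_fone : IsPointed D 0 (fone I) := by
  rw [← Ft_zero D]; exact isPointed_Ft D 0

variable (D) in
theorem isPointed_Et (L : List (I × ℤ)) : IsPointed D (L.map Y).sum (Et D L) := by
  induction L with
  | nil => rw [Et_nil]; exact isPointed_fone D
  | cons x L ih =>
    rw [sum_map_Y_cons, Et_cons]
    exact isPointed_fmul D (isPointed_Ft D _) ih

omit [Fintype I] [DecidableEq I] [Fintype J] [DecidableEq J] in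
theorem resList_cons (i : I) (p : ℤ) (L : List (J × ℤ)) :
    resList ι ((ι i, p) :: L) = (i, p) :: resList ι L := by
  rw [resList, List.filterMap_cons]
  have : Function.partialInv ι (ι i) = some i := Function.partialInv_left ι.injective i
  simp only [this, Option.map_some]
  rfl

omit [Fintype I] [DecidableEq I] [Fintype J] [DecidableEq J] in
theorem resList_cons_of_notMem {j : J} (hj : j ∉ Set.range ι) (p : ℤ) (L : List (J × ℤ)) :
    resList ι ((j, p) :: L) = resList ι L := by
  rw [resList, List.filterMap_cons]
  have : Function.partialInv ι j = none := by
    rw [Option.eq_none_iff_forall_ne_some]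
    intro i hi
    exact hj ⟨i, (ι.injective.isPartialInv i j).mp hi⟩
  simp only [this, Option.map_none]
  rfl

omit [Fintype I] [DecidableEq I] [Fintype J] [DecidableEq J] in
theorem sum_map_Y_resList (L : List (J × ℤ)) :
    ((resList ι L).map Y).sum = res ι (L.map Y).sum := by
  induction L with
  | nil => exact (res_zero ι).symm
  | cons x L ih =>
    obtain ⟨j, p⟩ := x
    rw [sum_map_Y_cons, res_add, ← ih]
    by_cases hj : j ∈ Set.range ι
    · obtain ⟨i, rfl⟩ := hj
      rw [resList_cons, sum_map_Y_cons, res_Y]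
    · rw [resList_cons_of_notMem hj, res_Y_of_notMem ι hj, zero_add]

omit [Fintype I] [DecidableEq I] [Fintype J] [DecidableEq J] in
theorem isOrderedFactorization_resList {L : List (J × ℤ)} {m : Mon J}
    (h : IsOrderedFactorization L m) : IsOrderedFactorization (resList ι L) (res ι m) := by
  refine ⟨by rw [sum_map_Y_resList, h.1], List.Pairwise.filterMap _ ?_ h.2⟩
  intro x y hxy x' hx' y' hy'
  obtain ⟨_, -, rfl⟩ := Option.map_eq_some_iff.mp hx'
  obtain ⟨_, -, rfl⟩ := Option.map_eq_some_iff.mp hy'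
  exact hxy

omit [Fintype J] [DecidableEq J] in
theorem isDom_Y (x : J × ℤ) : IsDom (Y x) := fun i p => by
  classical
  rw [Y, Finsupp.single_apply]; split_ifs <;> simp

theorem Et_incl (hι : IsInclusion D D' ι) (L : List (J × ℤ)) (v : RootExp I) :
    Et D' L ((L.map Y).sum - Aprod D' (incl ι v))
      = Et D (resList ι L) (res ι (L.map Y).sum - Aprod D v) := by
  induction L generalizing v with
  | nil =>
    have h0 : resList ι [] = [] := rfl
    rw [h0, Et_nil, Et_nil, ← Ft_zero D', ← Ft_zero D, List.map_nil, List.sum_nil,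
      Ft_incl hι (fun j _ p => le_rfl), res_zero]
  | cons x L ih =>
    obtain ⟨j, p⟩ := x
    have hp := isPointed_Et D (resList ι L)
    rw [sum_map_Y_resList] at hp
    rw [sum_map_Y_cons, Et_cons, fmul_incl hι (isPointed_Ft D' _) (isPointed_Et D' L)
      (isPointed_Ft D _) hp (Ft_incl hι fun k _ => isDom_Y (j, p) k) ih]
    by_cases hj : j ∈ Set.range ι
    · obtain ⟨i, rfl⟩ := hj
      rw [resList_cons, Et_cons, res_Y, sum_map_Y_resList]
    · rw [resList_cons_of_notMem hj, res_Y_of_notMem ι hj, Ft_zero, fone_fmul, gamma_zero_left,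
        neg_zero, LaurentPolynomial.T_zero, one_smul]

theorem freeze_Et (hι : IsInclusion D D' ι) (L : List (J × ℤ)) :
    freeze D' ι (Et D' L) = Et D (resList ι L) := by
  refine freeze_eq hι (isPointed_Et D' L) ?_ (Et_incl hι L)
  rw [← sum_map_Y_resList]
  exact (isPointed_Et D _).2

end Restriction

end FreezingQT

open FreezingQT in
theorem proposition3p6 {I J : Type*} [Fintype I] [DecidableEq I] [Fintype J] [DecidableEq J]
    (D : CartanDatum I) (D' : CartanDatum J) (ι : I ↪ J) (hι : IsInclusion D D' ι)
    (m : Mon J) (hm : IsDom m) :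
    -- freezing the element produced by the algorithm
    (IsPointed D' m (Ft D' m) ∧ freeze D' ι (Ft D' m) = Ft D (res ι m)) ∧
    -- freezing the element of the quantum Grothendieck ring
    (∀ x : QTorus D', IsFt D' m x → ⇑x = Ft D' m ∧
      ∃ y : QTorus D, ⇑y = freeze D' ι ⇑x ∧ IsFt D (res ι m) y ∧
        ∀ y' : QTorus D, IsFt D (res ι m) y' → y' = y) ∧
    -- freezing the standard basis element
    (∀ L : List (J × ℤ), IsOrderedFactorization L m →
      IsPointed D' m (Et D' L) ∧ IsOrderedFactorization (resList ι L) (res ι m) ∧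
      freeze D' ι (Et D' L) = Et D (resList ι L)) := by
  refine ⟨⟨isPointed_Ft D' m, freeze_Ft hι hm⟩, fun x hx => ?_, fun L hL => ?_⟩
  · obtain ⟨y, hy, hyF⟩ := exists_isFt_eq_freeze hι hm hx
    refine ⟨coe_eq_Ft_of_isFt D' hx, y, hy, hyF, fun y' hy' => QTorus.ext fun n => ?_⟩
    rw [coe_eq_Ft_of_isFt D hy', coe_eq_Ft_of_isFt D hyF]
  · refine ⟨?_, isOrderedFactorization_resList hL, freeze_Et hι L⟩
    have := isPointed_Et D' L
    rwa [hL.1] at this
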